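/- Let $n\ge2$, and let $\mathbb R_n$ be the real Clifford algebra generated by $e_1,\dots,e_n$ with $e_j^2=-1$ and $e_je_k+e_ke_j=0$ for $j\ne k$, with basis $(e_A)_{A\subset\{1,\dots,n\}}$ of ordered monomials and norm $|f|^2=\operatorname{Re}(f\bar f)=\sum_A|f_A|^2$ for $f=\sum_A f_Ae_A$; here $\operatorname{Re}(f)=f_\emptyset$, and $f\mapsto\bar f$ is the algebra anti-automorphism with $\overline{e_j}=-e_j$. Let $D=\sum_{j=1}^n e_j\partial_j$ be the Dirac operator. A domain is a nonempty connected open set. For a domain $\Omega\subset\mathbb R^n$ and a continuous weight $\varphi:\Omega\to\mathbb R$, let $L^2_\varphi(\Omega,\mathbb R_n)$ be the space of measurable $u:\Omega\to\mathbb R_n$ with $\|u\|_\varphi^2=\int_\Omega|u|^2e^{-\varphi}\,dV<\infty$. The equation $Du=f$ in $\Omega$ is understood in the sense of distributions: $\int_\Omega\operatorname{Re}(f\bar v)\,dV=\int_\Omega\operatorname{Re}(u\,\overline{Dv})\,dV$ for all $v\in C_c^\infty(\Omega,\mathbb R_n)$. Then the following hold. (1) Let $m\in\mathbb R\setminus\{0\}$,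 $\varphi=|x|^m$, and let $\Omega\subset\mathbb R^n\setminus\{0\}$ be a domain. For every $f\in L^2_\varphi(\Omega,\mathbb R_n)$ with $\int_\Omega\frac{|f|^2}{|x|^{m-2}}e^{-\varphi}\,dV<\infty$ there exists $u\in L^2_\varphi(\Omega,\mathbb R_n)$ with $Du=f$ in $\Omega$ and $$\|u\|_\varphi^2\le\int_\Omega\frac{|f|^2}{m^2|x|^{m-2}}e^{-\varphi}\,dV.$$ In particular, for $\varphi=|x|^2$ and every domain $\Omega\subset\mathbb R^n\setminus\{0\}$, every $f\in L^2_\varphi(\Omega,\mathbb R_n)$ admits a solution $u\in L^2_\varphi(\Omega,\mathbb R_n)$ of $Du=f$ with $\|u\|_\varphi^2\le\frac14\|f\|_\varphi^2$. If $\Omega=\mathbb R^n\setminus\{0\}$, the constant $\frac14$ is sharp: if $C\in\mathbb R$ is such that every $f\in L^2_\varphi(\Omega,\mathbb R_n)$ admits a solution $u\in L^2_\varphi(\Omega,\mathbb R_n)$ of $Du=f$ with $\|u\|_\varphi^2\le C\|f\|_\varphi^2$, then $C\ge\frac14$. (2) Let $\varphi=x_1^2$ and let $\Omega\subset\mathbb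 R^n$ be a domain. For every $f\in L^2_\varphi(\Omega,\mathbb R_n)$ there exists $u\in L^2_\varphi(\Omega,\mathbb R_n)$ with $Du=f$ in $\Omega$ and $\|u\|_\varphi^2\le\frac12\|f\|_\varphi^2$. (3) There exists $\varepsilon>0$, depending only on $n$, such that the following holds. Let $\varphi=\sum_{i=1}^n a_ix_i^2$ with $a_i\in\mathbb R$, $|a_i-1|<\varepsilon$ for all $i$, and let $\Omega\subset\mathbb R^n\setminus\overline{B(0,1)}$ be a domain. For every $f\in L^2_\varphi(\Omega,\mathbb R_n)$ there exists $u\in L^2_\varphi(\Omega,\mathbb R_n)$ with $Du=f$ in $\Omega$ and $\|u\|_\varphi^2\le\frac13\|f\|_\varphi^2$. -/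

import Mathlib

open scoped ContDiff symmDiff

noncomputable section

/-- The quadratic form `v ↦ -∑ vⱼ²` on `ℝⁿ`. -/
def cliffordForm (n : ℕ) : QuadraticForm ℝ (Fin n → ℝ) :=
  QuadraticMap.weightedSumSquares ℝ (fun _ : Fin n => (-1 : ℝ))

/-- The real Clifford algebra `ℝₙ`, with `eⱼ² = -1` and `eⱼ eₖ + eₖ eⱼ = 0` for `j ≠ k`. -/
abbrev Cl (n : ℕ) : Type := CliffordAlgebra (cliffordForm n)

namespace Cl

/-- The generators `e₁, …, eₙ`. -/
def e {n : ℕ} (j : Fin n) : Cl n := CliffordAlgebra.ι (cliffordForm n) (Pi.single j 1)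

/-- The product of generators along a list of indices. -/
def eList {n : ℕ} (l : List (Fin n)) : Cl n := (l.map e).prod

/-- The ordered monomial `e_A = e_{j₁} ⋯ e_{jₗ}`, `A = {j₁ < ⋯ < jₗ}`, with `e_∅ = 1`. -/
def eMon {n : ℕ} (A : Finset (Fin n)) : Cl n := eList A.sort

theorem e_mul_self {n : ℕ} (j : Fin n) : (e j : Cl n) * e j = -1 := by
  have h : cliffordForm n (Pi.single j 1) = -1 := by
    simp [cliffordForm, QuadraticMap.weightedSumSquares_apply, Pi.single_apply]
  rw [e, CliffordAlgebra.ι_sq_scalar, h, map_neg, map_one]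

theorem e_mul_e_of_ne {n : ℕ} {j k : Fin n} (h : j ≠ k) : (e j : Cl n) * e k = -(e k * e j) := by
  apply CliffordAlgebra.ι_mul_ι_comm_of_isOrtho
  rw [QuadraticMap.isOrtho_def]
  simp only [cliffordForm, QuadraticMap.weightedSumSquares_apply, Pi.add_apply, ← Finset.sum_add_distrib]
  refine Finset.sum_congr rfl fun i _ => ?_
  simp only [Pi.single_apply]
  by_cases h1 : i = j
  · subst h1; simp [h]
  · simp [h1]

theorem ι_eq_sum {n : ℕ} (v : Fin n → ℝ) :
    CliffordAlgebra.ι (cliffordForm n) v = ∑ j, v j • e j := by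
  conv_lhs => rw [← Finset.univ_sum_single v]
  rw [map_sum]
  refine Finset.sum_congr rfl fun j _ => ?_
  rw [e, ← map_smul]
  congr 1
  ext i
  simp [Pi.single_apply]

/-- The sign `±1` with `eⱼ e_A = ± e_{A ∆ {j}}`. -/
def sgn {n : ℕ} (j : Fin n) (A : Finset (Fin n)) : ℝ := ∏ i ∈ A, if i ≤ j then -1 else 1

theorem sgn_mul_self {n : ℕ} (j : Fin n) (A : Finset (Fin n)) : sgn j A * sgn j A = 1 := by
  rw [sgn, ← Finset.prod_mul_distrib]
  refine Finset.prod_eq_one fun i _ => ?_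
  split_ifs <;> norm_num

theorem sgn_symmDiff {n : ℕ} (j k : Fin n) (A : Finset (Fin n)) :
    sgn j (A ∆ {k}) = (if k ≤ j then -1 else 1) * sgn j A := by
  by_cases h : k ∈ A
  · have h1 : A ∆ {k} = A.erase k := by
      ext i; simp only [Finset.mem_symmDiff, Finset.mem_singleton, Finset.mem_erase]
      by_cases hi : i = k
      · subst hi; simp [h]
      · simp [hi]
    rw [h1, sgn, sgn, ← Finset.mul_prod_erase A _ h, ← mul_assoc]
    split_ifs <;> norm_num
  · have h1 : A ∆ {k} = insert k A := by
      ext i; simp only [Finset.mem_symmDiff, Finset.mem_singleton, Finset.mem_insert]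
      by_cases hi : i = k
      · subst hi; simp [h]
      · simp [hi]
    rw [h1, sgn, sgn, Finset.prod_insert h]

/-- Left multiplication by `eⱼ` on coefficient vectors. -/
def op {n : ℕ} (j : Fin n) : (Finset (Fin n) → ℝ) →ₗ[ℝ] (Finset (Fin n) → ℝ) where
  toFun f := fun B => sgn j (B ∆ {j}) * f (B ∆ {j})
  map_add' f g := by ext B; simp [mul_add]
  map_smul' c f := by ext B; simp [mul_left_comm]

theorem op_apply {n : ℕ} (j : Fin n) (f : Finset (Fin n) → ℝ) (B : Finset (Fin n)) :
    op j f B = sgn j (B ∆ {j}) * f (B ∆ {j}) := rfl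

theorem op_single {n : ℕ} (j : Fin n) (A : Finset (Fin n)) :
    op j (Pi.single A 1) = sgn j A • Pi.single (A ∆ {j}) 1 := by
  ext B
  rw [op_apply, Pi.smul_apply, smul_eq_mul, Pi.single_apply, Pi.single_apply]
  by_cases h : B = A ∆ {j}
  · subst h; simp
  · have : B ∆ {j} ≠ A := by
      rintro rfl; exact h (by simp)
    simp [h, this]

theorem op_op_self {n : ℕ} (j : Fin n) (f : Finset (Fin n) → ℝ) : op j (op j f) = -f := by
  ext B
  simp only [op_apply, symmDiff_symmDiff_cancel_right, Pi.neg_apply]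
  rw [sgn_symmDiff, ← mul_assoc]
  simp [sgn_mul_self]

theorem op_op_of_ne {n : ℕ} {j k : Fin n} (h : j ≠ k) (f : Finset (Fin n) → ℝ) :
    op j (op k f) = -op k (op j f) := by
  ext B
  simp only [op_apply, Pi.neg_apply, sgn_symmDiff, symmDiff_right_comm B {k} {j}]
  rcases lt_or_gt_of_ne h with h | h
  · simp [h.le, h.not_ge]; ring
  · simp [h.le, h.not_ge]; ring

/-- The representation of `ℝₙ` on coefficient vectors by left multiplication. -/
def leftRep (n : ℕ) : Cl n →ₐ[ℝ] Module.End ℝ (Finset (Fin n) → ℝ) :=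
  CliffordAlgebra.lift (cliffordForm n) ⟨∑ j, (LinearMap.proj j).smulRight (op j), fun v => by
    apply LinearMap.ext
    intro f
    simp only [LinearMap.smulRight_apply, LinearMap.proj_apply,
      Module.End.mul_apply, LinearMap.sum_apply, LinearMap.smul_apply, map_sum, map_smul,
      Module.algebraMap_end_apply, cliffordForm, QuadraticMap.weightedSumSquares_apply,
      Finset.smul_sum]
    have key : ∀ F : Fin n → Fin n → (Finset (Fin n) → ℝ), (∀ i j, i ≠ j → F i j = - F j i) →
        ∑ i, ∑ j, F i j = ∑ i, F i i := by
      intro F hF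
      have h1 : ∑ i, ∑ j, F i j = ∑ i, ∑ j, F j i := Finset.sum_comm
      have h2 : ∑ i, ∑ j, (F i j + F j i) = ∑ i, (F i i + F i i) := by
        refine Finset.sum_congr rfl fun i _ => ?_
        rw [Finset.sum_eq_single i]
        · intro j _ hj
          rw [hF j i hj]; simp
        · simp
      simp only [Finset.sum_add_distrib] at h2
      rw [← h1, ← two_smul ℝ, ← two_smul ℝ] at h2
      exact smul_right_injective _ (two_ne_zero (α := ℝ)) h2
    rw [key]
    · refine Finset.sum_congr rfl fun i _ => ?_
      rw [op_op_self]; module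
    · intro i j hij
      rw [op_op_of_ne hij]; module⟩

theorem leftRep_e {n : ℕ} (j : Fin n) : leftRep n (e j) = op j := by
  rw [leftRep, e, CliffordAlgebra.lift_ι_apply]
  simp only [LinearMap.coe_sum, Finset.sum_apply, LinearMap.smulRight_apply, LinearMap.proj_apply]
  rw [Finset.sum_eq_single j]
  · simp
  · intro k _ hk; simp [hk]
  · simp

/-- The coefficient vector of an element of `ℝₙ`. -/
def coeffs (n : ℕ) : Cl n →ₗ[ℝ] (Finset (Fin n) → ℝ) :=
  (LinearMap.applyₗ (Pi.single ∅ 1 : Finset (Fin n) → ℝ)) ∘ₗ (leftRep n).toLinearMap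

theorem coeffs_mul {n : ℕ} (f g : Cl n) : coeffs n (f * g) = leftRep n f (coeffs n g) := by
  simp [coeffs]

theorem coeffs_one (n : ℕ) : coeffs n 1 = Pi.single ∅ 1 := by
  simp [coeffs]

theorem coeffs_eMon {n : ℕ} (A : Finset (Fin n)) : coeffs n (eMon A) = Pi.single A 1 := by
  have key : ∀ l : List (Fin n), l.Pairwise (· < ·) →
      coeffs n (eList l) = Pi.single l.toFinset 1 := by
    intro l
    induction l with
    | nil => intro _; simp [eList, coeffs_one]
    | cons a t ih =>
      intro h
      rw [List.pairwise_cons] at h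
      have h0 : a ∉ t.toFinset := fun ha => lt_irrefl _ (h.1 a (by simpa using ha))
      have h1 : eList (a :: t) = e a * eList t := by simp [eList]
      rw [h1, coeffs_mul, ih h.2, leftRep_e, op_single]
      have h2 : sgn a t.toFinset = 1 :=
        Finset.prod_eq_one fun i hi => if_neg (h.1 i (by simpa using hi)).not_ge
      have h3 : t.toFinset ∆ {a} = (a :: t).toFinset := by
        ext i
        simp only [Finset.mem_symmDiff, Finset.mem_singleton, List.toFinset_cons, Finset.mem_insert]
        by_cases hi : i = a
        · subst hi; simp [h0]
        · simp [hi]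
      rw [h2, h3, one_smul]
  rw [eMon, key _ (Finset.sortedLT_sort A).pairwise, Finset.sort_toFinset]

theorem linearIndependent_eMon (n : ℕ) : LinearIndependent ℝ (eMon : Finset (Fin n) → Cl n) := by
  apply LinearIndependent.of_comp (coeffs n)
  convert (Pi.basisFun ℝ (Finset (Fin n))).linearIndependent using 1
  ext A : 1
  simp [coeffs_eMon]

theorem e_mul_eMon {n : ℕ} (j : Fin n) (A : Finset (Fin n)) :
    ∃ B, e j * eMon A = eMon B ∨ e j * eMon A = -eMon B := by
  have key : ∀ l : List (Fin n), l.Pairwise (· < ·) →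
      ∃ l' : List (Fin n), l'.Pairwise (· < ·) ∧ (∀ i ∈ l', i = j ∨ i ∈ l) ∧
        (e j * eList l = eList l' ∨ e j * eList l = -eList l') := by
    intro l
    induction l with
    | nil => intro _; exact ⟨[j], by simp, by simp, Or.inl (by simp [eList])⟩
    | cons a t ih =>
      intro h
      have h' := List.pairwise_cons.1 h
      have h1 : eList (a :: t) = e a * eList t := by simp [eList]
      rcases lt_trichotomy j a with hj | rfl | hj
      · refine ⟨j :: a :: t, ?_, by simp, Or.inl (by simp [eList])⟩
        rw [List.pairwise_cons]
        refine ⟨fun i hi => ?_, h⟩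
        rcases List.mem_cons.1 hi with rfl | hi
        · exact hj
        · exact hj.trans (h'.1 i hi)
      · refine ⟨t, h'.2, fun i hi => Or.inr (by simp [hi]), Or.inr ?_⟩
        rw [h1, ← mul_assoc, e_mul_self]; simp
      · obtain ⟨t', ht1, ht2, ht3⟩ := ih h'.2
        refine ⟨a :: t', ?_, ?_, ?_⟩
        · rw [List.pairwise_cons]
          refine ⟨fun i hi => ?_, ht1⟩
          rcases ht2 i hi with rfl | hi
          · exact hj
          · exact h'.1 i hi
        · intro i hi
          rcases List.mem_cons.1 hi with rfl | hi
          · simp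
          · rcases ht2 i hi with rfl | hi <;> simp [*]
        · have h2 : eList (a :: t') = e a * eList t' := by simp [eList]
          have h3 : e j * (e a * eList t) = -(e a * (e j * eList t)) := by
            rw [← mul_assoc, e_mul_e_of_ne hj.ne', neg_mul, mul_assoc]
          rw [h1, h2, h3]
          rcases ht3 with h4 | h4 <;> rw [h4] <;> simp
  obtain ⟨l', h1, -, h2⟩ := key _ (Finset.sortedLT_sort A).pairwise
  refine ⟨l'.toFinset, ?_⟩
  have h3 : l'.toFinset.sort = l' :=
    (List.toFinset_sort (r := (· ≤ ·)) (h1.imp ne_of_lt)).2 (h1.imp le_of_lt)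
  rw [eMon, eMon, h3]
  exact h2

theorem span_eMon (n : ℕ) : ⊤ ≤ Submodule.span ℝ (Set.range (eMon : Finset (Fin n) → Cl n)) := by
  set S := Submodule.span ℝ (Set.range (eMon : Finset (Fin n) → Cl n)) with hS
  have he : ∀ (j : Fin n), ∀ y ∈ S, e j * y ∈ S := by
    intro j y hy
    induction hy using Submodule.span_induction with
    | mem y hy =>
      obtain ⟨A, rfl⟩ := hy
      obtain ⟨B, hB | hB⟩ := e_mul_eMon j A <;> rw [hB]
      · exact Submodule.subset_span ⟨B, rfl⟩
      · exact S.neg_mem (Submodule.subset_span ⟨B, rfl⟩)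
    | zero => simp
    | add a b _ _ ha hb => rw [mul_add]; exact S.add_mem ha hb
    | smul c a _ ha => rw [mul_smul_comm]; exact S.smul_mem c ha
  have key : ∀ x : Cl n, ∀ y ∈ S, x * y ∈ S := by
    intro x
    induction x using CliffordAlgebra.induction with
    | algebraMap r => intro y hy; rw [← Algebra.smul_def]; exact S.smul_mem r hy
    | ι v =>
      intro y hy
      rw [ι_eq_sum, Finset.sum_mul]
      refine S.sum_mem fun j _ => ?_
      rw [smul_mul_assoc]; exact S.smul_mem _ (he j y hy)
    | mul a b ha hb => intro y hy; rw [mul_assoc]; exact ha _ (hb y hy)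
    | add a b ha hb => intro y hy; rw [add_mul]; exact S.add_mem (ha y hy) (hb y hy)
  intro x _
  have h1 : (1 : Cl n) ∈ S := Submodule.subset_span ⟨∅, by simp [eMon, eList]⟩
  simpa using key x 1 h1

/-- The basis `(e_A)_A` of `ℝₙ`, indexed by the subsets `A` of `{1, …, n}`. -/
def basis (n : ℕ) : Module.Basis (Finset (Fin n)) ℝ (Cl n) :=
  Module.Basis.mk (linearIndependent_eMon n) (span_eMon n)

theorem basis_apply {n : ℕ} (A : Finset (Fin n)) : basis n A = eMon A := by
  simp [basis]

theorem coeffs_eq_repr {n : ℕ} (f : Cl n) (A : Finset (Fin n)) :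
    coeffs n f A = (basis n).repr f A := by
  have : coeffs n = (basis n).equivFun.toLinearMap := by
    apply (basis n).ext
    intro B
    rw [basis_apply, coeffs_eMon, ← basis_apply]
    ext A
    simp [Pi.single_apply, eq_comm]
  rw [this]; simp

/-- The scalar part `Re f = f_∅` of `f = ∑ f_A e_A`. -/
def re {n : ℕ} (f : Cl n) : ℝ := (basis n).repr f ∅

theorem eList_perm {n : ℕ} {l l' : List (Fin n)} (h : l.Perm l') :
    eList l = eList l' ∨ eList l = -eList l' := by
  induction h with
  | nil => simp
  | cons a _ ih =>
    simp only [eList, List.map_cons, List.prod_cons] at ih ⊢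
    rcases ih with ih | ih <;> rw [ih] <;> simp
  | swap a b l =>
    simp only [eList, List.map_cons, List.prod_cons]
    by_cases hab : b = a
    · subst hab; simp
    · right
      rw [← mul_assoc, e_mul_e_of_ne hab, neg_mul, mul_assoc]
  | trans _ _ h1 h2 =>
    rcases h1 with h1 | h1 <;> rcases h2 with h2 | h2 <;> rw [h1, h2] <;> simp

theorem star_eList {n : ℕ} (l : List (Fin n)) :
    star (eList l) = eList l.reverse ∨ star (eList l) = -eList l.reverse := by
  induction l with
  | nil => simp [eList]
  | cons a t ih =>
    have h1 : star (eList (a :: t)) = star (eList t) * (-e a) := by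
      simp [eList, e, star_mul]
    have h2 : eList (a :: t).reverse = eList t.reverse * e a := by simp [eList]
    rw [h1, h2]
    rcases ih with ih | ih <;> rw [ih] <;> simp

theorem star_eMon {n : ℕ} (A : Finset (Fin n)) :
    star (eMon A) = eMon A ∨ star (eMon A) = -eMon A := by
  have h1 := star_eList A.sort
  have h2 := eList_perm (List.reverse_perm A.sort)
  rw [eMon]
  rcases h1 with h1 | h1 <;> rcases h2 with h2 | h2 <;> rw [h1, h2] <;> simp

theorem dot_op {n : ℕ} (j : Fin n) (f g : Finset (Fin n) → ℝ) :
    ∑ A, op j f A * g A = -∑ A, f A * op j g A := by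
  rw [← Finset.sum_neg_distrib]
  refine Finset.sum_bij' (fun A _ => A ∆ {j}) (fun A _ => A ∆ {j}) (by simp) (by simp) (by simp)
    (by simp) ?_
  intro A _
  simp only [op_apply, symmDiff_symmDiff_cancel_right, sgn_symmDiff]
  simp; ring

theorem dot_leftRep {n : ℕ} (x : Cl n) : ∀ f g : Finset (Fin n) → ℝ,
    ∑ A, leftRep n x f A * g A = ∑ A, f A * leftRep n (star x) g A := by
  induction x using CliffordAlgebra.induction with
  | algebraMap r =>
    intro f g
    simp [CliffordAlgebra.star_algebraMap, mul_left_comm, mul_assoc]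
  | ι v =>
    intro f g
    rw [CliffordAlgebra.star_ι, ι_eq_sum]
    have h1 : ∀ F h : Finset (Fin n) → ℝ, ∑ A, leftRep n (∑ j, v j • e j) F A * h A =
        ∑ j, v j * ∑ A, op j F A * h A := by
      intro F h
      simp only [map_sum, map_smul, leftRep_e, LinearMap.sum_apply, LinearMap.smul_apply,
        Finset.sum_apply, Pi.smul_apply, smul_eq_mul, Finset.sum_mul, Finset.mul_sum, mul_assoc]
      rw [Finset.sum_comm (γ := Fin n)]
    rw [h1]
    have h2 : ∑ A, f A * leftRep n (-∑ j, v j • e j) g A =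
        -∑ A, leftRep n (∑ j, v j • e j) g A * f A := by
      rw [map_neg, ← Finset.sum_neg_distrib]
      refine Finset.sum_congr rfl fun A _ => ?_
      rw [LinearMap.neg_apply, Pi.neg_apply]; ring
    rw [h2, h1, ← Finset.sum_neg_distrib]
    refine Finset.sum_congr rfl fun j _ => ?_
    rw [dot_op, mul_neg]
    simp only [mul_comm]
  | mul a b ha hb =>
    intro f g
    rw [star_mul, map_mul, map_mul, Module.End.mul_apply, ha, hb]; rfl
  | add a b ha hb =>
    intro f g
    simp only [star_add, map_add, LinearMap.add_apply, Pi.add_apply, add_mul, mul_add,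
      Finset.sum_add_distrib, ha, hb]

/-- `Re (f ḡ) = ∑ f_A g_A`; `star` is the Clifford conjugation, the anti-automorphism with
`star eⱼ = -eⱼ`. -/
theorem re_mul_star {n : ℕ} (f g : Cl n) :
    re (f * star g) = ∑ A, (basis n).repr f A * (basis n).repr g A := by
  have h1 : ∀ A : Finset (Fin n), ∃ s : ℝ, s * s = 1 ∧ star (eMon A) = s • eMon A := by
    intro A
    rcases star_eMon A with h | h
    · exact ⟨1, by norm_num, by rw [h, one_smul]⟩
    · exact ⟨-1, by norm_num, by rw [h, neg_one_smul]⟩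
  choose s hs1 hs2 using h1
  have h2 : ∀ (x : Cl n) (A : Finset (Fin n)), coeffs n (star x) A = s A * coeffs n x A := by
    intro x A
    induction span_eMon n (Submodule.mem_top (x := x)) using Submodule.span_induction with
    | mem y hy =>
      obtain ⟨B, rfl⟩ := hy
      rw [hs2, map_smul, coeffs_eMon]
      by_cases h : A = B
      · subst h; simp
      · simp [h]
    | zero => simp
    | add a b _ _ ha hb => simp only [star_add, map_add, Pi.add_apply, ha, hb]; ring
    | smul c a _ ha =>
      simp only [CliffordAlgebra.star_smul, map_smul, Pi.smul_apply, smul_eq_mul, ha]; ring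
  have h3 : re (f * star g) = ∑ A, leftRep n f (coeffs n (star g)) A *
      (Pi.single ∅ 1 : Finset (Fin n) → ℝ) A := by
    rw [re, ← coeffs_eq_repr, coeffs_mul]
    simp [Pi.single_apply]
  rw [h3, dot_leftRep, ← coeffs_one, ← coeffs_mul, mul_one]
  refine Finset.sum_congr rfl fun A _ => ?_
  rw [h2, h2, ← coeffs_eq_repr, ← coeffs_eq_repr]
  linear_combination (coeffs n f A * coeffs n g A) * hs1 A

/-- The inner product `⟨f, g⟩ = Re (f ḡ)` on `ℝₙ`. -/
abbrev innerCore (n : ℕ) : InnerProductSpace.Core ℝ (Cl n) where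
  inner f g := re (f * star g)
  conj_inner_symm f g := by simp [re_mul_star, mul_comm]
  re_inner_nonneg f := by
    rw [re_mul_star, RCLike.re_to_real]
    exact Finset.sum_nonneg fun A _ => mul_self_nonneg ((basis n).repr f A)
  add_left f g h := by simp [re, add_mul]
  smul_left f g r := by simp [re]
  definite f h := by
    rw [re_mul_star, Finset.sum_eq_zero_iff_of_nonneg
      (fun A _ => mul_self_nonneg ((basis n).repr f A))] at h
    apply (basis n).repr.injective
    ext A
    simpa using h A (Finset.mem_univ A)

/-- `ℝₙ` carries the norm `|f|² = Re (f f̄) = ∑ |f_A|²`. -/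
instance instNormedAddCommGroup (n : ℕ) : NormedAddCommGroup (Cl n) :=
  (innerCore n).toNormedAddCommGroup

instance instInnerProductSpace (n : ℕ) : InnerProductSpace ℝ (Cl n) :=
  InnerProductSpace.ofCore (innerCore n).toCore

theorem inner_def {n : ℕ} (f g : Cl n) : inner ℝ f g = re (f * star g) := rfl

theorem norm_sq_eq {n : ℕ} (f : Cl n) : ‖f‖ ^ 2 = ∑ A, (basis n).repr f A ^ 2 := by
  rw [← real_inner_self_eq_norm_sq, inner_def, re_mul_star]
  simp only [sq]

end Cl

/-- Euclidean space `ℝⁿ`. -/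
abbrev Eucl (n : ℕ) : Type := EuclideanSpace ℝ (Fin n)

/-- The (left) Dirac operator `Du = ∑ⱼ eⱼ ∂ⱼu` on differentiable functions. -/
def diracOp {n : ℕ} (u : Eucl n → Cl n) (x : Eucl n) : Cl n :=
  ∑ j : Fin n, Cl.e j * fderiv ℝ u x (EuclideanSpace.single j 1)

/-- `∫_Ω g e^{-φ} dV ∈ [0, ∞]` for a nonnegative function `g`. -/
def wInt {n : ℕ} (Ω : Set (Eucl n)) (φ g : Eucl n → ℝ) : ENNReal :=
  ∫⁻ x in Ω, ENNReal.ofReal (g x * Real.exp (-φ x))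

/-- `‖u‖_φ² = ∫_Ω |u|² e^{-φ} dV ∈ [0, ∞]`. -/
def wNormSq {n : ℕ} (Ω : Set (Eucl n)) (φ : Eucl n → ℝ) (u : Eucl n → Cl n) : ENNReal :=
  wInt Ω φ fun x => ‖u x‖ ^ 2

/-- Membership in `L²_φ(Ω, ℝₙ)`; only the values of `u` on `Ω` matter. -/
def MemL2 {n : ℕ} (Ω : Set (Eucl n)) (φ : Eucl n → ℝ) (u : Eucl n → Cl n) : Prop :=
  MeasureTheory.AEStronglyMeasurable u (MeasureTheory.volume.restrict Ω) ∧ wNormSq Ω φ u < ⊤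

/-- `Du = f` on `Ω` in the sense of distributions: `⟨f, v⟩₀ = ⟨u, Dv⟩₀` for all
`v ∈ C_c^∞(Ω, ℝₙ)`, where `⟨f, g⟩₀ = ∫_Ω Re (f ḡ) dV`. -/
def DiracEq {n : ℕ} (Ω : Set (Eucl n)) (u f : Eucl n → Cl n) : Prop :=
  MeasureTheory.LocallyIntegrableOn u Ω ∧ MeasureTheory.LocallyIntegrableOn f Ω ∧
  ∀ v : Eucl n → Cl n, ContDiff ℝ ∞ v → HasCompactSupport v → tsupport v ⊆ Ω →
    ∫ x in Ω, inner ℝ (f x) (v x) = ∫ x in Ω, inner ℝ (u x) (diracOp v x)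

end

/-! By duality, solving `Du = f` with a weighted bound amounts to the a priori estimate `∫ ψ e^φ
|v|² ≤ ∫ e^φ |Dv|²` for test functions `v`: Hahn–Banach and Riesz give the solution
(`exists_diracEq_of_estimate`), and testing with `f = e^φ v` gives the converse
(`integral_le_of_solvable`), which is needed for sharpness.

For the estimate, put `w = e^{φ/2} v`, so that `e^{φ/2} Dv = Dw - ½ ∇φ w`. In every case `∇φ = k c`
with `k` a scalar function and `c` a vector field with coordinates `αⱼ xⱼ + βⱼ`. Since Clifford
vectors satisfy `c² = -|c|²`, one may write `w = -c g` wherever `c ≠ 0`. With `s = |c|²`, the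
identity `integral_norm_sq_weighted` reads `∫ |Dw - (k/2) c w|² = ∫ s |Dg - (k/2) w|² + ∫ (c · ∇(s
k)) |g|² + ∫ defect`. Its ingredients are `D² = -Δ`, the formal self-adjointness of `D`, and the
skew-adjointness of multiplication by vectors. The first term on the right is nonnegative, and the
second gives the constant.

The defect vanishes for `α = 0` and for `α = 1`. Taking `c = x` gives `m² |x|^(m-2)` for `φ =
|x|^m`, and `c = e₁` gives `2` for `φ = x₁²`. For `φ = ∑ aᵢ xᵢ²` one takes `c = (aᵢ xᵢ)`; the defect
is then of first order in `a - 1` and is absorbed (`le_twistDefect`), lowering the constant from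
about `4` to `3`.

For sharpness, `g = e^{-|x|²/2}` satisfies `Dg = -x g = w`, so the discarded square vanishes and the
ratio of energies is exactly `4`. Cutting `g` off near `0` and near infinity costs an error that
tends to `0` (`tendsto_shell_remainder`). -/

namespace Cl

/-! ### Clifford vectors acting by left multiplication -/

variable {n : ℕ}

instance instFiniteDimensional : FiniteDimensional ℝ (Cl n) :=
  Module.Finite.of_basis (basis n)

instance instCompleteSpace : CompleteSpace (Cl n) := FiniteDimensional.complete ℝ _

theorem inner_eq_sum_coeffs (f g : Cl n) :
    inner ℝ f g = ∑ A, coeffs n f A * coeffs n g A := by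
  rw [inner_def, re_mul_star]
  simp only [coeffs_eq_repr]

/-- Left multiplication by a generator is skew-adjoint. -/
theorem inner_e_mul (j : Fin n) (f g : Cl n) :
    inner ℝ (e j * f) g = -inner ℝ f (e j * g) := by
  simp only [inner_eq_sum_coeffs, coeffs_mul, leftRep_e, dot_op]

/-- The Clifford vector with coordinates `p`. -/
noncomputable def vec (p : Fin n → ℝ) : Cl n := ∑ j, p j • e j

theorem vec_mul (p : Fin n → ℝ) (f : Cl n) : vec p * f = ∑ j, p j • (e j * f) := by
  simp only [vec, Finset.sum_mul, smul_mul_assoc]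

theorem vec_smul (r : ℝ) (p : Fin n → ℝ) : vec (r • p) = r • vec p := by
  simp only [vec, Finset.smul_sum, Pi.smul_apply, smul_eq_mul, mul_smul]

theorem vec_add (p q : Fin n → ℝ) : vec (p + q) = vec p + vec q := by
  simp only [vec, Pi.add_apply, add_smul, Finset.sum_add_distrib]

theorem vec_mul_self (p : Fin n → ℝ) : vec p * vec p = algebraMap ℝ (Cl n) (-∑ j, p j ^ 2) := by
  have h : cliffordForm n p = -∑ j, p j ^ 2 := by
    simp [cliffordForm, QuadraticMap.weightedSumSquares_apply, sq]
  rw [vec, ← ι_eq_sum, CliffordAlgebra.ι_sq_scalar, h]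

theorem vec_mul_vec_mul (p : Fin n → ℝ) (f : Cl n) :
    vec p * (vec p * f) = -((∑ j, p j ^ 2) • f) := by
  rw [← mul_assoc, vec_mul_self, ← Algebra.smul_def, neg_smul]

theorem inner_vec_mul (p : Fin n → ℝ) (f g : Cl n) :
    inner ℝ (vec p * f) g = -inner ℝ f (vec p * g) := by
  simp only [vec_mul, sum_inner, inner_sum, inner_smul_left, inner_smul_right, inner_e_mul,
    ← Finset.sum_neg_distrib]
  simp

theorem norm_vec_mul_sq (p : Fin n → ℝ) (f : Cl n) :
    ‖vec p * f‖ ^ 2 = (∑ j, p j ^ 2) * ‖f‖ ^ 2 := by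
  rw [← real_inner_self_eq_norm_sq, inner_vec_mul, vec_mul_vec_mul, inner_neg_right, neg_neg,
    inner_smul_right, real_inner_self_eq_norm_sq]

/-- Polarization of `norm_vec_mul_sq`. -/
theorem inner_vec_mul_vec_mul (p q : Fin n → ℝ) (f : Cl n) :
    inner ℝ (vec p * f) (vec q * f) = (∑ j, p j * q j) * ‖f‖ ^ 2 := by
  have h := norm_vec_mul_sq (p + q) f
  rw [vec_add, add_mul, norm_add_sq_real, norm_vec_mul_sq, norm_vec_mul_sq] at h
  have h2 : ∑ j, (p + q) j ^ 2 = ∑ j, p j ^ 2 + 2 * ∑ j, p j * q j + ∑ j, q j ^ 2 := by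
    rw [Finset.mul_sum, ← Finset.sum_add_distrib, ← Finset.sum_add_distrib]
    exact Finset.sum_congr rfl fun j _ => by simp only [Pi.add_apply]; ring
  rw [h2] at h
  linarith

theorem norm_e_mul (j : Fin n) (f : Cl n) : ‖e j * f‖ = ‖f‖ := by
  rw [← sq_eq_sq₀ (norm_nonneg _) (norm_nonneg _), ← real_inner_self_eq_norm_sq, inner_e_mul,
    ← mul_assoc, e_mul_self, neg_one_mul, inner_neg_right, neg_neg, real_inner_self_eq_norm_sq]

/-- Left multiplication by a generator. -/
noncomputable def eL (j : Fin n) : Cl n →L[ℝ] Cl n :=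
  LinearMap.toContinuousLinearMap (LinearMap.mulLeft ℝ (e j))

theorem e_mul_e_mul (j k : Fin n) (f : Cl n) (h : j ≠ k) :
    e j * (e k * f) = -(e k * (e j * f)) := by
  rw [← mul_assoc, e_mul_e_of_ne h, neg_mul, mul_assoc]

theorem e_mul_e_mul_self (j : Fin n) (f : Cl n) : e j * (e j * f) = -f := by
  rw [← mul_assoc, e_mul_self, neg_one_mul]

end Cl

/-! ### Test functions and integration by parts for the Dirac operator -/

noncomputable section

variable {n : ℕ}

/-- The partial derivative in the `j`-th coordinate direction. -/
def pd {F : Type*} [NormedAddCommGroup F] [NormedSpace ℝ F] (j : Fin n) (u : Eucl n → F)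
    (x : Eucl n) : F := fderiv ℝ u x (EuclideanSpace.single j 1)

theorem diracOp_eq (u : Eucl n → Cl n) (x : Eucl n) :
    diracOp u x = ∑ j, Cl.e j * pd j u x := rfl

/-- The gradient of a real function, as a coordinate vector. -/
def gradVec (h : Eucl n → ℝ) (x : Eucl n) : Fin n → ℝ := fun j => pd j h x

/-- Smooth functions with compact support in `Ω`. -/
structure IsTest {F : Type*} [NormedAddCommGroup F] [NormedSpace ℝ F] (Ω : Set (Eucl n))
    (u : Eucl n → F) : Prop where
  smooth : ContDiff ℝ ∞ u
  cpt : HasCompactSupport u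
  sub : tsupport u ⊆ Ω

section
variable {F : Type*} [NormedAddCommGroup F] [NormedSpace ℝ F] {Ω : Set (Eucl n)}

protected theorem IsTest.differentiable {u : Eucl n → F} (h : IsTest Ω u) : Differentiable ℝ u :=
  h.smooth.differentiable (by simp)

protected theorem IsTest.continuous {u : Eucl n → F} (h : IsTest Ω u) : Continuous u :=
  h.smooth.continuous

protected theorem IsTest.pd {u : Eucl n → F} (h : IsTest Ω u) (j : Fin n) : IsTest Ω (pd j u) := by
  have h1 : ContDiff ℝ ∞ (pd j u) :=
    (h.smooth.fderiv_right (m := ∞) (by simp)).clm_apply contDiff_const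
  have h2 : tsupport (pd j u) ⊆ tsupport u :=
    tsupport_fderiv_apply_subset ℝ _
  exact ⟨h1, h.cpt.mono' ((subset_tsupport _).trans h2), h2.trans h.sub⟩

protected theorem IsTest.add {u v : Eucl n → F} (hu : IsTest Ω u) (hv : IsTest Ω v) :
    IsTest Ω (fun x => u x + v x) := by
  refine ⟨hu.smooth.add hv.smooth, hu.cpt.add hv.cpt, (tsupport_add u v).trans ?_⟩
  exact Set.union_subset hu.sub hv.sub

theorem isTest_zero : IsTest Ω (fun _ : Eucl n => (0 : F)) := by
  refine ⟨contDiff_const, HasCompactSupport.zero, ?_⟩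
  have : tsupport (fun _ : Eucl n => (0 : F)) = ∅ := tsupport_eq_empty_iff.2 rfl
  simp [this]

protected theorem IsTest.sum {ι : Type*} (s : Finset ι) {u : ι → Eucl n → F}
    (hu : ∀ i ∈ s, IsTest Ω (u i)) : IsTest Ω (fun x => ∑ i ∈ s, u i x) := by
  classical
  induction s using Finset.induction_on with
  | empty => simpa using isTest_zero
  | insert a s ha ih =>
    simp only [Finset.sum_insert ha]
    exact (hu a (by simp)).add (ih fun i hi => hu i (by simp [hi]))

theorem IsTest.clm {G : Type*} [NormedAddCommGroup G] [NormedSpace ℝ G] {u : Eucl n → F}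
    (hu : IsTest Ω u) (T : F →L[ℝ] G) : IsTest Ω (fun x => T (u x)) :=
  ⟨T.contDiff.comp hu.smooth, hu.cpt.comp_left (map_zero T),
    (tsupport_comp_subset (map_zero T) u).trans hu.sub⟩

/-- The factor need only be smooth on `Ω`, because the product vanishes near every point outside the
support of `u`. This admits factors such as `|x|^m`, singular at the origin. -/
protected theorem IsTest.smul {u : Eucl n → F} (hu : IsTest Ω u) (hΩ : IsOpen Ω) {h : Eucl n → ℝ}
    (hh : ContDiffOn ℝ ∞ h Ω) : IsTest Ω (fun x => h x • u x) := by
  have hs : tsupport (fun x => h x • u x) ⊆ tsupport u := tsupport_smul_subset_right h u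
  refine ⟨contDiff_iff_contDiffAt.2 fun x => ?_, hu.cpt.mono' ((subset_tsupport _).trans hs),
    hs.trans hu.sub⟩
  by_cases hx : x ∈ tsupport u
  · exact ((hh x (hu.sub hx)).contDiffAt (hΩ.mem_nhds (hu.sub hx))).smul hu.smooth.contDiffAt
  · have : (fun x => h x • u x) =ᶠ[nhds x] fun _ => 0 := by
      rw [notMem_tsupport_iff_eventuallyEq] at hx
      filter_upwards [hx] with y hy
      simp [hy]
    exact contDiffAt_const.congr_of_eventuallyEq this

theorem IsTest.const_smul {u : Eucl n → F} (hu : IsTest Ω u) (r : ℝ) :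
    IsTest Ω (fun x => r • u x) := hu.clm (r • ContinuousLinearMap.id ℝ F)

theorem IsTest.eq_zero {u : Eucl n → F} (hu : IsTest Ω u) {x : Eucl n} (hx : x ∉ Ω) : u x = 0 :=
  image_eq_zero_of_notMem_tsupport fun h => hx (hu.sub h)

protected theorem IsTest.integrable {u : Eucl n → F} (hu : IsTest Ω u) :
    MeasureTheory.Integrable u := hu.continuous.integrable_of_hasCompactSupport hu.cpt

end

section
variable {Ω : Set (Eucl n)} {u v : Eucl n → Cl n}

theorem IsTest.e_mul (hu : IsTest Ω u) (j : Fin n) : IsTest Ω (fun x => Cl.e j * u x) :=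
  hu.clm (Cl.eL j)

protected theorem IsTest.diracOp (hu : IsTest Ω u) : IsTest Ω (diracOp u) :=
  IsTest.sum Finset.univ fun j _ => (hu.pd j).e_mul j

theorem IsTest.vec_mul (hu : IsTest Ω u) (hΩ : IsOpen Ω) {p : Eucl n → Fin n → ℝ}
    (hp : ∀ j, ContDiffOn ℝ ∞ (fun x => p x j) Ω) : IsTest Ω (fun x => Cl.vec (p x) * u x) := by
  simp only [Cl.vec_mul]
  exact IsTest.sum Finset.univ fun j _ => (hu.e_mul j).smul hΩ (hp j)

protected theorem IsTest.inner (hu : IsTest Ω u) (hv : IsTest Ω v) :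
    IsTest Ω (fun x => inner ℝ (u x) (v x)) := by
  refine ⟨hu.smooth.inner ℝ hv.smooth, ?_, ?_⟩
  · exact hu.cpt.mono fun x hx h => hx (by simp only [h, inner_zero_left])
  · refine (closure_mono ?_).trans hu.sub
    exact fun x hx h => hx (by simp only [h, inner_zero_left])

theorem IsTest.integrable_inner (hu : IsTest Ω u) (hv : IsTest Ω v) :
    MeasureTheory.Integrable (fun x => inner ℝ (u x) (v x)) := (hu.inner hv).integrable

theorem IsTest.integrable_sq (hu : IsTest Ω u) :
    MeasureTheory.Integrable (fun x => ‖u x‖ ^ 2) := by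
  simpa only [real_inner_self_eq_norm_sq] using hu.integrable_inner hu

theorem integral_inner_pd (hu : IsTest Ω u) (hv : IsTest Ω v) (j : Fin n) :
    ∫ x, inner ℝ (pd j u x) (v x) = -∫ x, inner ℝ (u x) (pd j v x) := by
  have : ∫ x, inner ℝ (u x) (pd j v x) = -∫ x, inner ℝ (pd j u x) (v x) :=
    integral_bilinear_fderiv_right_eq_neg_left_of_integrable
      (μ := (MeasureTheory.volume : MeasureTheory.Measure (Eucl n)))
      (f := u) (g := v) (v := EuclideanSpace.single j 1) (B := innerSL ℝ)
      ((hu.pd j).integrable_inner hv) (hu.integrable_inner (hv.pd j))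
      (hu.integrable_inner hv) (fun x _ => hu.differentiable x) (fun x _ => hv.differentiable x)
  rw [this, neg_neg]

theorem pd_e_mul (hu : Differentiable ℝ u) (j k : Fin n) (x : Eucl n) :
    pd j (fun x => Cl.e k * u x) x = Cl.e k * pd j u x := by
  have := ((Cl.eL k).hasFDerivAt.comp x (hu x).hasFDerivAt).fderiv
  simp only [pd]
  change (fderiv ℝ ((Cl.eL k) ∘ u) x) _ = _
  rw [this]; rfl

theorem pd_pd_comm {F : Type*} [NormedAddCommGroup F] [NormedSpace ℝ F] {u : Eucl n → F}
    (hu : IsTest Ω u) (j k : Fin n) (x : Eucl n) :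
    pd j (pd k u) x = pd k (pd j u) x := by
  have h1 : ∀ i, pd i u = fun y => fderiv ℝ u y (EuclideanSpace.single i 1) := fun i => rfl
  have h2 : DifferentiableAt ℝ (fderiv ℝ u) x :=
    (hu.smooth.fderiv_right (m := ∞) (by simp)).differentiable (by simp) x
  have h3 : ∀ a b, pd a (pd b u) x =
      fderiv ℝ (fderiv ℝ u) x (EuclideanSpace.single a 1) (EuclideanSpace.single b 1) := by
    intro a b
    rw [pd, h1, fderiv_clm_apply h2 (differentiableAt_const _)]
    simp
  rw [h3, h3]
  exact (hu.smooth.contDiffAt.isSymmSndFDerivAt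
    (by simp only [minSmoothness_of_isRCLikeNormedField]; exact ENat.LEInfty.out)) _ _

/-- The Dirac operator is formally self-adjoint. -/
theorem integral_inner_diracOp (hu : IsTest Ω u) (hv : IsTest Ω v) :
    ∫ x, inner ℝ (diracOp u x) (v x) = ∫ x, inner ℝ (u x) (diracOp v x) := by
  simp only [diracOp_eq, sum_inner, inner_sum]
  rw [MeasureTheory.integral_finsetSum _ fun j _ => ((hu.pd j).e_mul j).integrable_inner hv,
    MeasureTheory.integral_finsetSum _ fun j _ => hu.integrable_inner ((hv.pd j).e_mul j)]
  refine Finset.sum_congr rfl fun j _ => ?_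
  simp only [Cl.inner_e_mul]
  rw [MeasureTheory.integral_neg, integral_inner_pd hu (hv.e_mul j), neg_neg]
  simp only [pd_e_mul hv.differentiable]

theorem integral_inner_pd_pd_comm (hu : IsTest Ω u) (hv : IsTest Ω v) (j k : Fin n) :
    ∫ x, inner ℝ (pd j u x) (pd k v x) = ∫ x, inner ℝ (pd k u x) (pd j v x) := by
  rw [integral_inner_pd hu (hv.pd k), integral_inner_pd hu (hv.pd j)]
  simp only [pd_pd_comm hv j k]

/-- Polarized form of `‖Du‖² = ∑ ‖∂ⱼu‖²`, which reflects `D² = -Δ`. -/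
theorem integral_inner_diracOp_diracOp (hu : IsTest Ω u) (hv : IsTest Ω v) :
    ∫ x, inner ℝ (diracOp u x) (diracOp v x) = ∫ x, ∑ j, inner ℝ (pd j u x) (pd j v x) := by
  have hi : ∀ j k, MeasureTheory.Integrable
      (fun x => inner ℝ (Cl.e j * pd j u x) (Cl.e k * pd k v x)) := fun j k =>
    ((hu.pd j).e_mul j).integrable_inner ((hv.pd k).e_mul k)
  set F : Fin n → Fin n → ℝ := fun j k => ∫ x, inner ℝ (Cl.e j * pd j u x) (Cl.e k * pd k v x)
    with hF
  -- Under the integral the two derivatives may be exchanged, while `eⱼ` and `eₖ` anticommute; hence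
  -- all off-diagonal terms cancel in pairs.
  have hanti : ∀ j k, j ≠ k → F j k = -F k j := by
    intro j k hjk
    simp only [hF]
    have h1 : ∀ a b : Fin n, ∀ w z : Cl n, inner ℝ (Cl.e a * w) (Cl.e b * z) =
        -inner ℝ w (Cl.e a * (Cl.e b * z)) := fun a b w z => Cl.inner_e_mul _ _ _
    have h2 := integral_inner_pd_pd_comm hu ((hv.e_mul k).e_mul j) j k
    simp only [pd_e_mul (hv.e_mul k).differentiable, pd_e_mul hv.differentiable] at h2
    simp only [h1]
    rw [MeasureTheory.integral_neg, MeasureTheory.integral_neg, h2, neg_neg,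
      ← MeasureTheory.integral_neg]
    refine MeasureTheory.integral_congr_ae (Filter.Eventually.of_forall fun x => ?_)
    simp only
    rw [Cl.e_mul_e_mul j k _ hjk, inner_neg_right, neg_neg]
  have hdiag : ∀ j, F j j = ∫ x, inner ℝ (pd j u x) (pd j v x) := by
    intro j
    simp only [hF]
    refine MeasureTheory.integral_congr_ae (Filter.Eventually.of_forall fun x => ?_)
    simp only
    rw [Cl.inner_e_mul, Cl.e_mul_e_mul_self, inner_neg_right, neg_neg]
  have h1 : ∫ x, inner ℝ (diracOp u x) (diracOp v x) = ∑ j, ∑ k, F j k := by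
    simp only [diracOp_eq, sum_inner, inner_sum]
    rw [MeasureTheory.integral_finsetSum _ fun j _ =>
      MeasureTheory.integrable_finsetSum _ fun k _ => hi k j]
    rw [Finset.sum_comm]
    refine Finset.sum_congr rfl fun j _ => ?_
    rw [MeasureTheory.integral_finsetSum _ fun k _ => hi k j]
  rw [h1, MeasureTheory.integral_finsetSum _ fun j _ => (hu.pd j).integrable_inner (hv.pd j)]
  simp only [← hdiag]
  have h2 : ∑ j, ∑ k, F j k = ∑ j, ∑ k, F k j := Finset.sum_comm
  have h3 : ∑ j, ∑ k, (F j k + F k j) = ∑ j, (F j j + F j j) := by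
    refine Finset.sum_congr rfl fun j _ => ?_
    rw [Finset.sum_eq_single j]
    · intro k _ hk
      rw [hanti j k hk.symm]; simp
    · simp
  simp only [Finset.sum_add_distrib] at h3
  linarith

end
end

/-! ### Affine vector fields and the twisted energy identity -/

noncomputable section

variable {n : ℕ}

section
variable {F : Type*} [NormedAddCommGroup F] [NormedSpace ℝ F]

theorem pd_smul {h : Eucl n → ℝ} {u : Eucl n → F} {x : Eucl n} (hh : DifferentiableAt ℝ h x)
    (hu : DifferentiableAt ℝ u x) (j : Fin n) :
    pd j (fun x => h x • u x) x = h x • pd j u x + pd j h x • u x := by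
  simp only [pd]
  rw [fderiv_fun_smul hh hu]
  simp

theorem pd_sum {ι : Type*} (s : Finset ι) {u : ι → Eucl n → F} {x : Eucl n}
    (hu : ∀ i ∈ s, DifferentiableAt ℝ (u i) x) (j : Fin n) :
    pd j (fun x => ∑ i ∈ s, u i x) x = ∑ i ∈ s, pd j (u i) x := by
  simp only [pd]
  rw [fderiv_fun_sum hu]
  simp

theorem pd_neg (u : Eucl n → F) (j : Fin n) (x : Eucl n) :
    pd j (fun x => -u x) x = -pd j u x := by
  simp only [pd]
  rw [fderiv_fun_neg]
  simp

end

theorem diracOp_smul {h : Eucl n → ℝ} {u : Eucl n → Cl n} {x : Eucl n}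
    (hh : DifferentiableAt ℝ h x) (hu : DifferentiableAt ℝ u x) :
    diracOp (fun x => h x • u x) x = h x • diracOp u x + Cl.vec (gradVec h x) * u x := by
  simp only [diracOp_eq, pd_smul hh hu, mul_add, mul_smul_comm, Finset.sum_add_distrib,
    Finset.smul_sum, Cl.vec_mul, gradVec]

/-- The vector field with coordinates `αⱼ xⱼ + βⱼ`. -/
def affineField (α β : Fin n → ℝ) (x : Eucl n) : Fin n → ℝ := fun j => α j * x j + β j

theorem contDiff_affineField (α β : Fin n → ℝ) (j : Fin n) :
    ContDiff ℝ ∞ (fun x : Eucl n => affineField α β x j) := by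
  unfold affineField
  fun_prop

theorem pd_affineField (α β : Fin n → ℝ) (j k : Fin n) (x : Eucl n) :
    pd j (fun x => affineField α β x k) x = if k = j then α k else 0 := by
  have h : HasFDerivAt (fun x : Eucl n => affineField α β x k)
      (α k • (EuclideanSpace.proj k : Eucl n →L[ℝ] ℝ)) x := by
    have := ((EuclideanSpace.proj (𝕜 := ℝ) k).hasFDerivAt (x := x)).const_mul (α k)
    exact this.add_const (β k)
  rw [pd, h.fderiv]
  simp

/-- The squared length of the affine field. -/
def affineSq (α β : Fin n → ℝ) (x : Eucl n) : ℝ := ∑ j, affineField α β x j ^ 2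

theorem contDiff_affineSq (α β : Fin n → ℝ) : ContDiff ℝ ∞ (affineSq (n := n) α β) :=
  ContDiff.sum fun j _ => (contDiff_affineField α β j).pow 2

theorem gradVec_affineSq (α β : Fin n → ℝ) (x : Eucl n) :
    gradVec (affineSq α β) x = (2 : ℝ) • fun j => α j * affineField α β x j := by
  have hd : ∀ k, DifferentiableAt ℝ (fun x : Eucl n => affineField α β x k) x := fun k =>
    (contDiff_affineField α β k).differentiable (by simp) x
  have h : affineSq (n := n) α β =
      fun x => ∑ k, affineField α β x k • affineField α β x k := by
    ext x; simp only [affineSq, smul_eq_mul, sq]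
  ext j
  rw [gradVec, h, pd_sum _ (fun k _ => DifferentiableAt.fun_smul (hd k) (hd k))]
  simp only [pd_smul (hd _) (hd _), pd_affineField]
  rw [Finset.sum_eq_single j]
  · simp; ring
  · intro k _ hk; simp [hk]
  · simp

theorem pd_affineField_mul (α β : Fin n → ℝ) {g : Eucl n → Cl n} (hg : Differentiable ℝ g)
    (j : Fin n) (x : Eucl n) :
    pd j (fun x => Cl.vec (affineField α β x) * g x) x =
      α j • (Cl.e j * g x) + Cl.vec (affineField α β x) * pd j g x := by
  have hd : ∀ k, DifferentiableAt ℝ (fun x : Eucl n => affineField α β x k) x := fun k =>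
    (contDiff_affineField α β k).differentiable (by simp) x
  have he : ∀ k : Fin n, DifferentiableAt ℝ (fun x => Cl.e k * g x) x := fun k =>
    (Cl.eL k).differentiableAt.comp x (hg x)
  simp only [Cl.vec_mul]
  rw [pd_sum _ (fun k _ => DifferentiableAt.fun_smul (hd k) (he k))]
  simp only [pd_smul (hd _) (he _), pd_affineField, pd_e_mul hg, Finset.sum_add_distrib]
  rw [add_comm]
  congr 1
  rw [Finset.sum_eq_single j]
  · simp
  · intro k _ hk; simp [hk]
  · simp

/-- The function `-c g`, where `c` is the affine field. -/
def twist (α β : Fin n → ℝ) (g : Eucl n → Cl n) (x : Eucl n) : Cl n :=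
  -(Cl.vec (affineField α β x) * g x)

section
variable {Ω : Set (Eucl n)} {g : Eucl n → Cl n} (α β : Fin n → ℝ)

protected theorem IsTest.twist (hg : IsTest Ω g) (hΩ : IsOpen Ω) : IsTest Ω (twist α β g) := by
  have := (hg.vec_mul hΩ (p := affineField α β)
    fun j => (contDiff_affineField α β j).contDiffOn).const_smul (-1)
  simp only [neg_one_smul] at this
  exact this

theorem field_mul_twist (x : Eucl n) :
    Cl.vec (affineField α β x) * twist α β g x = affineSq α β x • g x := by
  rw [_root_.twist, mul_neg, Cl.vec_mul_vec_mul, neg_neg]; rfl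

theorem norm_twist_sq (x : Eucl n) :
    ‖twist α β g x‖ ^ 2 = affineSq α β x * ‖g x‖ ^ 2 := by
  rw [_root_.twist, norm_neg, Cl.norm_vec_mul_sq]; rfl

theorem pd_twist (hg : Differentiable ℝ g) (j : Fin n) (x : Eucl n) :
    pd j (twist α β g) x = -(α j • (Cl.e j * g x)) - Cl.vec (affineField α β x) * pd j g x := by
  change pd j (fun x => -(Cl.vec (affineField α β x) * g x)) x = _
  rw [pd_neg, pd_affineField_mul α β hg]
  abel

/-- The deviation of the twisted Dirac energy from the untwisted one. -/
def twistDefect (α β : Fin n → ℝ) (g : Eucl n → Cl n) (x : Eucl n) : ℝ :=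
  2 * inner ℝ (diracOp g x) (Cl.vec (fun j => α j * affineField α β x j) * g x) -
    2 * ∑ j, α j * inner ℝ (pd j g x) (Cl.e j * twist α β g x)

open MeasureTheory

variable {α β}

theorem integrable_twistDefect (hg : IsTest Ω g) (hΩ : IsOpen Ω) :
    Integrable (twistDefect α β g) := by
  have hw := hg.twist α β hΩ
  refine ((hg.diracOp.integrable_inner (hg.vec_mul hΩ fun j =>
    (contDiff_const.mul (contDiff_affineField α β j)).contDiffOn)).const_mul 2).sub ?_
  exact (integrable_finsetSum _ fun j _ =>
    ((hg.pd j).integrable_inner (hw.e_mul j)).const_mul (α j)).const_mul 2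

/-- With `s = |c|²`, compute `∫ ⟨Dg, D(s g)⟩` in two ways: by the product rule for `D`, and as `∫ ∑
⟨∂ⱼg, ∂ⱼ(s g)⟩` with `s g = c w`. The second reproduces `∫ ∑ |∂ⱼw|² = ∫ |Dw|²` up to terms in `∂ⱼc =
αⱼ eⱼ`. -/
theorem integral_norm_diracOp_twist (hg : IsTest Ω g) (hΩ : IsOpen Ω) :
    ∫ x, ‖diracOp (twist α β g) x‖ ^ 2 =
      (∫ x, affineSq α β x * ‖diracOp g x‖ ^ 2) + ∫ x, twistDefect α β g x := by
  have hw := hg.twist α β hΩ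
  set w := twist α β g with hwdef
  have hsg : IsTest Ω (fun x => affineSq α β x • g x) :=
    hg.smul hΩ (contDiff_affineSq α β).contDiffOn
  have hd : IsTest Ω (fun x => Cl.vec (fun j => α j * affineField α β x j) * g x) :=
    hg.vec_mul hΩ fun j => (contDiff_const.mul (contDiff_affineField α β j)).contDiffOn
  have h1 := integral_inner_diracOp_diracOp hg hsg
  have h2 := integral_inner_diracOp_diracOp hw hw
  have hDs : ∀ x, diracOp (fun x => affineSq α β x • g x) x = affineSq α β x • diracOp g x +
      (2 : ℝ) • (Cl.vec (fun j => α j * affineField α β x j) * g x) := by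
    intro x
    rw [diracOp_smul ((contDiff_affineSq α β).differentiable (by simp) x) (hg.differentiable x),
      gradVec_affineSq, Cl.vec_smul, smul_mul_assoc]
  -- Differentiate `s g = c w`, move `c` onto `∂ⱼg` by skew-adjointness, and replace `c ∂ⱼg` by
  -- `-∂ⱼw - αⱼ eⱼ g`.
  have hps : ∀ j x, inner ℝ (pd j g x) (pd j (fun x => affineSq α β x • g x) x) =
      inner ℝ (pd j w x) (pd j w x) + α j * inner ℝ (Cl.e j * g x) (pd j w x) +
        α j * inner ℝ (pd j g x) (Cl.e j * w x) := by
    intro j x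
    have e1 : (fun x => affineSq α β x • g x) =
        fun x => Cl.vec (affineField α β x) * w x := by
      ext x; rw [hwdef, field_mul_twist]
    have e2 := pd_twist α β hg.differentiable j x
    rw [← hwdef] at e2
    have e3 : Cl.vec (affineField α β x) * pd j g x = -pd j w x - α j • (Cl.e j * g x) := by
      rw [e2]; abel
    rw [e1, pd_affineField_mul α β hw.differentiable, inner_add_right, inner_smul_right]
    have e4 : inner ℝ (pd j g x) (Cl.vec (affineField α β x) * pd j w x) =
        -inner ℝ (Cl.vec (affineField α β x) * pd j g x) (pd j w x) := by
      rw [Cl.inner_vec_mul, neg_neg]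
    rw [e4, e3, inner_sub_left, inner_neg_left, inner_smul_left]
    simp; ring
  -- Both `∂ⱼ` and multiplication by `eⱼ` are skew-adjoint, so the two signs cancel.
  have hcross : ∀ j, ∫ x, inner ℝ (Cl.e j * g x) (pd j w x) =
      ∫ x, inner ℝ (pd j g x) (Cl.e j * w x) := by
    intro j
    have := integral_inner_pd (hg.e_mul j) hw j
    simp only [pd_e_mul hg.differentiable, Cl.inner_e_mul] at this
    rw [integral_neg] at this
    simp only [Cl.inner_e_mul]
    rw [integral_neg]
    have h3 := integral_inner_pd hg (hw.e_mul j) j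
    simp only [pd_e_mul hw.differentiable] at h3
    linarith
  have i1 : ∀ j, Integrable fun x => inner ℝ (pd j w x) (pd j w x) := fun j =>
    (hw.pd j).integrable_inner (hw.pd j)
  have i2 : ∀ j, Integrable fun x => α j * inner ℝ (Cl.e j * g x) (pd j w x) := fun j =>
    ((hg.e_mul j).integrable_inner (hw.pd j)).const_mul _
  have i3 : ∀ j, Integrable fun x => α j * inner ℝ (pd j g x) (Cl.e j * w x) := fun j =>
    ((hg.pd j).integrable_inner (hw.e_mul j)).const_mul _
  have h4 : ∫ x, inner ℝ (diracOp g x) (diracOp (fun x => affineSq α β x • g x) x) =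
      (∫ x, ‖diracOp w x‖ ^ 2) + 2 * ∫ x, ∑ j, α j * inner ℝ (pd j g x) (Cl.e j * w x) := by
    rw [h1]
    simp only [hps]
    rw [integral_finsetSum _ fun j _ => ((i1 j).fun_add (i2 j)).fun_add (i3 j),
      integral_finsetSum _ fun j _ => i3 j]
    simp only [← real_inner_self_eq_norm_sq]
    rw [h2, integral_finsetSum _ fun j _ => i1 j, Finset.mul_sum, ← Finset.sum_add_distrib]
    refine Finset.sum_congr rfl fun j _ => ?_
    rw [integral_add ((i1 j).fun_add (i2 j)) (i3 j), integral_add (i1 j) (i2 j),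
      integral_const_mul, integral_const_mul, hcross]
    ring
  have h5 : ∫ x, inner ℝ (diracOp g x) (diracOp (fun x => affineSq α β x • g x) x) =
      (∫ x, affineSq α β x * ‖diracOp g x‖ ^ 2) +
        ∫ x, 2 * inner ℝ (diracOp g x) (Cl.vec (fun j => α j * affineField α β x j) * g x) := by
    rw [← integral_add]
    · refine integral_congr_ae (Filter.Eventually.of_forall fun x => ?_)
      simp only
      rw [hDs, inner_add_right, inner_smul_right, inner_smul_right, real_inner_self_eq_norm_sq]
    · have := hg.diracOp.integrable_inner
        (hg.diracOp.smul hΩ (contDiff_affineSq α β).contDiffOn)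
      simpa only [inner_smul_right, real_inner_self_eq_norm_sq] using this
    · exact (hg.diracOp.integrable_inner hd).const_mul 2
  have h6 : ∫ x, twistDefect α β g x =
      (∫ x, 2 * inner ℝ (diracOp g x) (Cl.vec (fun j => α j * affineField α β x j) * g x)) -
        2 * ∫ x, ∑ j, α j * inner ℝ (pd j g x) (Cl.e j * w x) := by
    rw [← integral_const_mul, ← integral_sub]
    · rfl
    · exact (hg.diracOp.integrable_inner hd).const_mul 2
    · exact (integrable_finsetSum _ fun j _ => i3 j).const_mul 2
  linarith

/-- The basic energy identity for the weighted Dirac operator. -/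
theorem integral_norm_sq_weighted (hg : IsTest Ω g) (hΩ : IsOpen Ω) {k : Eucl n → ℝ}
    (hk : ContDiffOn ℝ ∞ k Ω) :
    ∫ x, ‖diracOp (twist α β g) x -
        (k x / 2) • (Cl.vec (affineField α β x) * twist α β g x)‖ ^ 2 =
      (∫ x, affineSq α β x * ‖diracOp g x - (k x / 2) • twist α β g x‖ ^ 2) +
      (∫ x, (∑ j, affineField α β x j * gradVec (fun y => affineSq α β y * k y) x j) *
        ‖g x‖ ^ 2) + ∫ x, twistDefect α β g x := by
  have hw := hg.twist α β hΩ
  have hR := integral_norm_diracOp_twist (α := α) (β := β) hg hΩ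
  have hsw := contDiff_affineSq α β (n := n)
  simp only [field_mul_twist]
  have hnorm := norm_twist_sq (g := g) α β
  set w := twist α β g with hwdef
  set l : Eucl n → ℝ := fun y => affineSq α β y * k y with hl
  have hlc : ContDiffOn ℝ ∞ l Ω := hsw.contDiffOn.mul hk
  -- Here `l = s k`. The commutator of `D` with `l` is multiplication by `∇l`, and `⟨g, ∇l w⟩ = ⟨∇l
  -- g, c g⟩ = (c · ∇l) |g|²`. This is the only source of the zeroth-order term.
  have hDl : ∀ x, inner ℝ (g x) (diracOp (fun x => l x • w x) x) =
      l x * inner ℝ (g x) (diracOp w x) +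
        (∑ j, affineField α β x j * gradVec l x j) * ‖g x‖ ^ 2 := by
    intro x
    by_cases hx : x ∈ Ω
    · have hd : DifferentiableAt ℝ l x :=
        ((hlc x hx).contDiffAt (hΩ.mem_nhds hx)).differentiableAt (by simp)
      rw [diracOp_smul hd (hw.differentiable x), inner_add_right, inner_smul_right,
        ← Cl.inner_vec_mul_vec_mul, Cl.inner_vec_mul, hwdef]
      congr 1
      rw [_root_.twist, mul_neg, inner_neg_right, ← Cl.inner_vec_mul, ← Cl.inner_vec_mul,
        real_inner_comm]
    · simp [hg.eq_zero hx]
  have h1 : ∫ x, inner ℝ (diracOp g x) (l x • w x) =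
      ∫ x, inner ℝ (g x) (diracOp (fun x => l x • w x) x) :=
    integral_inner_diracOp hg (hw.smul hΩ hlc)
  have iz : Integrable fun x => (∑ j, affineField α β x j * gradVec l x j) * ‖g x‖ ^ 2 := by
    have h := (hg.integrable_inner (hw.smul hΩ hlc).diracOp).sub
      (hg.integrable_inner (hw.diracOp.smul hΩ hlc))
    refine h.congr (Filter.Eventually.of_forall fun x => ?_)
    simp only [Pi.sub_apply]
    rw [hDl, inner_smul_right]; ring
  have i1 : Integrable fun x => l x * inner ℝ (g x) (diracOp w x) := by
    simpa only [inner_smul_right] using hg.integrable_inner (hw.diracOp.smul hΩ hlc)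
  have i2 : Integrable fun x => inner ℝ (diracOp g x) (l x • w x) :=
    hg.diracOp.integrable_inner (hw.smul hΩ hlc)
  simp only [hDl] at h1
  rw [integral_add i1 iz] at h1
  have i3 : Integrable fun x => ‖diracOp w x‖ ^ 2 := hw.diracOp.integrable_sq
  have i4 : Integrable fun x => affineSq α β x * ‖diracOp g x‖ ^ 2 := by
    have := hg.diracOp.integrable_inner (hg.diracOp.smul hΩ hsw.contDiffOn)
    simpa only [inner_smul_right, real_inner_self_eq_norm_sq] using this
  have hkk : ContDiffOn ℝ ∞ (fun x => affineSq α β x * (k x ^ 2 / 4)) Ω :=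
    hsw.contDiffOn.mul ((hk.pow 2).div_const 4)
  have i5 : Integrable fun x => affineSq α β x * (k x ^ 2 / 4) * ‖w x‖ ^ 2 := by
    have := hw.integrable_inner (hw.smul hΩ hkk)
    simpa only [inner_smul_right, real_inner_self_eq_norm_sq] using this
  -- Expanding the two squares leaves the same quadratic term, since `s² |g|² = s |w|²`. Only the
  -- cross terms differ, and `h1` compares them.
  have e1 : ∀ x, ‖diracOp w x - (k x / 2) • affineSq α β x • g x‖ ^ 2 =
      ‖diracOp w x‖ ^ 2 - l x * inner ℝ (g x) (diracOp w x) +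
        affineSq α β x * (k x ^ 2 / 4) * ‖w x‖ ^ 2 := by
    intro x
    rw [norm_sub_sq_real, smul_smul, inner_smul_right, norm_smul, mul_pow, Real.norm_eq_abs,
      sq_abs, hnorm, real_inner_comm]
    simp only [hl]; ring
  have e2 : ∀ x, affineSq α β x * ‖diracOp g x - (k x / 2) • w x‖ ^ 2 =
      affineSq α β x * ‖diracOp g x‖ ^ 2 - inner ℝ (diracOp g x) (l x • w x) +
        affineSq α β x * (k x ^ 2 / 4) * ‖w x‖ ^ 2 := by
    intro x
    rw [norm_sub_sq_real, inner_smul_right, norm_smul, mul_pow, Real.norm_eq_abs,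
      sq_abs, inner_smul_right]
    simp only [hl]; ring
  simp only [e1, e2]
  have f1 : ∫ x, (‖diracOp w x‖ ^ 2 - l x * inner ℝ (g x) (diracOp w x) +
      affineSq α β x * (k x ^ 2 / 4) * ‖w x‖ ^ 2) = (∫ x, ‖diracOp w x‖ ^ 2) -
        (∫ x, l x * inner ℝ (g x) (diracOp w x)) +
        ∫ x, affineSq α β x * (k x ^ 2 / 4) * ‖w x‖ ^ 2 := by
    rw [← integral_sub i3 i1]
    exact integral_add (i3.sub i1) i5
  have f2 : ∫ x, (affineSq α β x * ‖diracOp g x‖ ^ 2 - inner ℝ (diracOp g x) (l x • w x) +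
      affineSq α β x * (k x ^ 2 / 4) * ‖w x‖ ^ 2) = (∫ x, affineSq α β x * ‖diracOp g x‖ ^ 2) -
        (∫ x, inner ℝ (diracOp g x) (l x • w x)) +
        ∫ x, affineSq α β x * (k x ^ 2 / 4) * ‖w x‖ ^ 2 := by
    rw [← integral_sub i4 i2]
    exact integral_add (i4.sub i2) i5
  rw [f1, f2]
  linarith

end
end

/-! ### Duality: from an a priori estimate to a weak solution -/

noncomputable section

/-- Duality principle: if `‖S v‖ ≤ ‖T v‖` for all `v`, then `F ∘ S` factors through `T` with
norm at most `‖F‖`. -/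
theorem exists_inner_map_eq_inner_map {V H : Type*} [AddCommGroup V] [Module ℝ V]
    [NormedAddCommGroup H] [InnerProductSpace ℝ H] [CompleteSpace H] (S T : V →ₗ[ℝ] H)
    (hST : ∀ v, ‖S v‖ ≤ ‖T v‖) (F : H) :
    ∃ h : H, ‖h‖ ≤ ‖F‖ ∧ ∀ v, inner ℝ h (T v) = inner ℝ F (S v) := by
  -- Any linear section `σ` of `T` serves: the hypothesis puts `ker T` inside `ker S`, so `S ∘ σ`
  -- does not depend on the choice. The functional `⟨F, S σ ·⟩` on the range of `T` is then extended
  -- by Hahn–Banach and represented by Riesz.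
  obtain ⟨σ, hσ⟩ := T.rangeRestrict.exists_rightInverse_of_surjective T.range_rangeRestrict
  have hσ' : ∀ y : LinearMap.range T, T (σ y) = y := fun y =>
    congrArg Subtype.val (LinearMap.congr_fun hσ y)
  have hle : ∀ y : LinearMap.range T,
      ‖((innerₛₗ ℝ F) ∘ₗ S ∘ₗ σ) y‖ ≤ ‖F‖ * ‖y‖ := by
    intro y
    calc ‖inner ℝ F (S (σ y))‖ ≤ ‖F‖ * ‖S (σ y)‖ := norm_inner_le_norm _ _
      _ ≤ ‖F‖ * ‖T (σ y)‖ := by gcongr; exact hST _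
      _ = ‖F‖ * ‖y‖ := by rw [hσ']; rfl
  obtain ⟨G, hG1, hG2⟩ := exists_extension_norm_eq (LinearMap.range T)
    (LinearMap.mkContinuous _ ‖F‖ hle)
  refine ⟨(InnerProductSpace.toDual ℝ H).symm G, ?_, fun v => ?_⟩
  · rw [LinearIsometryEquiv.norm_map, hG2]
    exact LinearMap.mkContinuous_norm_le _ (norm_nonneg _) _
  · rw [InnerProductSpace.toDual_symm_apply]
    have h1 := hG1 ⟨T v, LinearMap.mem_range_self T v⟩
    simp only at h1
    rw [h1]
    change inner ℝ F (S (σ ⟨T v, _⟩)) = _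
    have h2 : S (σ ⟨T v, LinearMap.mem_range_self T v⟩) - S v = 0 := by
      rw [← map_sub, ← norm_le_zero_iff]
      refine (hST _).trans ?_
      rw [map_sub, hσ']; simp
    rw [sub_eq_zero.1 h2]

open MeasureTheory

theorem ofReal_norm_sq_eq_lintegral {α E : Type*} [MeasurableSpace α] {μ : Measure α}
    [NormedAddCommGroup E] [InnerProductSpace ℝ E] (F : Lp E 2 μ) :
    ENNReal.ofReal (‖F‖ ^ 2) = ∫⁻ x, ENNReal.ofReal (‖F x‖ ^ 2) ∂μ := by
  have h : ‖F‖ ^ 2 = ∫ x, ‖F x‖ ^ 2 ∂μ := by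
    rw [← real_inner_self_eq_norm_sq, L2.inner_def]
    simp only [real_inner_self_eq_norm_sq]
  rw [h, ofReal_integral_eq_lintegral_ofReal]
  · exact (memLp_two_iff_integrable_sq_norm (Lp.aestronglyMeasurable F)).1 (Lp.memLp F)
  · exact Filter.Eventually.of_forall fun x => sq_nonneg _

theorem memLp_two_of_lintegral_lt_top {α E : Type*} [MeasurableSpace α] {μ : Measure α}
    [NormedAddCommGroup E] {G : α → E} (hG : AEStronglyMeasurable G μ)
    (h : ∫⁻ x, ENNReal.ofReal (‖G x‖ ^ 2) ∂μ < ⊤) : MemLp G 2 μ := by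
  rw [memLp_two_iff_integrable_sq_norm hG]
  refine ⟨hG.norm.pow 2, ?_⟩
  rwa [hasFiniteIntegral_iff_ofReal (Filter.Eventually.of_forall fun x => sq_nonneg _)]

variable {n : ℕ} {Ω : Set (Eucl n)}

theorem diracOp_add {u v : Eucl n → Cl n} {x : Eucl n} (hu : DifferentiableAt ℝ u x)
    (hv : DifferentiableAt ℝ v x) : diracOp (u + v) x = diracOp u x + diracOp v x := by
  simp only [diracOp, fderiv_add hu hv, add_apply, mul_add, Finset.sum_add_distrib]

theorem diracOp_const_smul (r : ℝ) {u : Eucl n → Cl n} {x : Eucl n}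
    (hu : DifferentiableAt ℝ u x) : diracOp (r • u) x = r • diracOp u x := by
  simp only [diracOp, fderiv_const_smul hu, smul_apply, mul_smul_comm, Finset.smul_sum]

/-- The space of test functions on `Ω`. -/
def testSpace (Ω : Set (Eucl n)) : Submodule ℝ (Eucl n → Cl n) where
  carrier := {v | IsTest Ω v}
  add_mem' hu hv := hu.add hv
  zero_mem' := isTest_zero
  smul_mem' r _ hu := hu.const_smul r

/-- The Dirac operator on test functions. -/
def testDirac (Ω : Set (Eucl n)) : testSpace Ω →ₗ[ℝ] testSpace Ω where
  toFun v := ⟨diracOp v.1, v.2.diracOp⟩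
  map_add' u v := Subtype.ext <| funext fun x =>
    diracOp_add (u.2.differentiable x) (v.2.differentiable x)
  map_smul' r u := Subtype.ext <| funext fun x => diracOp_const_smul r (u.2.differentiable x)

theorem IsTest.continuous_smul {v : Eucl n → Cl n} (hv : IsTest Ω v) (hΩ : IsOpen Ω)
    {h : Eucl n → ℝ} (hh : ContinuousOn h Ω) : Continuous (fun x => h x • v x) := by
  rw [continuous_iff_continuousAt]
  intro x
  by_cases hx : x ∈ tsupport v
  · exact (hh.continuousAt (hΩ.mem_nhds (hv.sub hx))).smul hv.continuous.continuousAt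
  · have : (fun x => h x • v x) =ᶠ[nhds x] fun _ => 0 := by
      rw [notMem_tsupport_iff_eventuallyEq] at hx
      filter_upwards [hx] with y hy
      simp [hy]
    exact continuousAt_const.congr this.symm

theorem IsTest.memLp_smul {v : Eucl n → Cl n} (hv : IsTest Ω v) (hΩ : IsOpen Ω)
    {h : Eucl n → ℝ} (hh : ContinuousOn h Ω) :
    MemLp (fun x => h x • v x) 2 (volume.restrict Ω) := by
  have h1 : HasCompactSupport (fun x => h x • v x) := hv.cpt.mono fun x hx h0 => hx (by simp [h0])
  have h2 : MemLp (fun x => h x • v x) 2 volume :=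
    (hv.continuous_smul hΩ hh).memLp_of_hasCompactSupport h1
  exact h2.restrict Ω

/-- Multiplication by a continuous function, from test functions to `L²(Ω)`. -/
def testMul (hΩ : IsOpen Ω) {h : Eucl n → ℝ} (hh : ContinuousOn h Ω) :
    testSpace Ω →ₗ[ℝ] Lp (Cl n) 2 (volume.restrict Ω) where
  toFun v := (v.2.memLp_smul hΩ hh).toLp
  map_add' u v := by
    rw [← MemLp.toLp_add]
    exact MemLp.toLp_congr _ _ (Filter.Eventually.of_forall fun x => smul_add (h x) (u.1 x) (v.1 x))
  map_smul' r u := by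
    rw [RingHom.id_apply, ← MemLp.toLp_const_smul]
    exact MemLp.toLp_congr _ _ (Filter.Eventually.of_forall fun x => smul_comm (h x) r (u.1 x))

theorem coeFn_testMul (hΩ : IsOpen Ω) {h : Eucl n → ℝ} (hh : ContinuousOn h Ω)
    (v : testSpace Ω) :
    testMul hΩ hh v =ᵐ[volume.restrict Ω] fun x => h x • v.1 x :=
  (v.2.memLp_smul hΩ hh).coeFn_toLp

theorem norm_testMul_sq (hΩ : IsOpen Ω) {h : Eucl n → ℝ} (hh : ContinuousOn h Ω)
    (v : testSpace Ω) : ‖testMul hΩ hh v‖ ^ 2 = ∫ x, h x ^ 2 * ‖v.1 x‖ ^ 2 := by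
  have h1 : ∫ x, h x ^ 2 * ‖v.1 x‖ ^ 2 = ∫ x in Ω, h x ^ 2 * ‖v.1 x‖ ^ 2 := by
    rw [setIntegral_eq_integral_of_forall_compl_eq_zero]
    intro x hx
    rw [v.2.eq_zero hx]; simp
  rw [h1, ← real_inner_self_eq_norm_sq, L2.inner_def]
  refine integral_congr_ae ?_
  filter_upwards [coeFn_testMul hΩ hh v] with x hx
  rw [hx, real_inner_self_eq_norm_sq, norm_smul, mul_pow, Real.norm_eq_abs, sq_abs]

/-- `L²`-existence for `Du = f` from the a priori estimate on test functions. -/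
theorem exists_diracEq_of_estimate (hΩ : IsOpen Ω) {φ ψ : Eucl n → ℝ}
    (hφ : ContinuousOn φ Ω) (hψ : ContinuousOn ψ Ω) (hψ0 : ∀ x ∈ Ω, 0 < ψ x)
    (hest : ∀ v, IsTest Ω v →
      ∫ x, ψ x * Real.exp (φ x) * ‖v x‖ ^ 2 ≤ ∫ x, Real.exp (φ x) * ‖diracOp v x‖ ^ 2)
    {f : Eucl n → Cl n} (hfm : AEStronglyMeasurable f (volume.restrict Ω))
    (hf : wInt Ω φ (fun x => ‖f x‖ ^ 2 / ψ x) < ⊤) :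
    ∃ u : Eucl n → Cl n, MemL2 Ω φ u ∧ DiracEq Ω u f ∧
      wNormSq Ω φ u ≤ wInt Ω φ (fun x => ‖f x‖ ^ 2 / ψ x) := by
  set μ : Measure (Eucl n) := volume.restrict Ω with hμ
  have hmeas : MeasurableSet Ω := hΩ.measurableSet
  have hE : ContinuousOn (fun x => Real.exp (φ x / 2)) Ω := (hφ.div_const 2).rexp
  have hEψ : ContinuousOn (fun x => Real.exp (φ x / 2) * √(ψ x)) Ω := hE.mul hψ.sqrt
  have hE2 : ∀ x, Real.exp (φ x / 2) ^ 2 = Real.exp (φ x) := fun x => by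
    rw [← Real.exp_nat_mul]; congr 1; push_cast; ring
  have hpos : ∀ x ∈ Ω, 0 < Real.exp (φ x / 2) * √(ψ x) := fun x hx =>
    mul_pos (Real.exp_pos _) (Real.sqrt_pos.2 (hψ0 x hx))
  have hinv : ContinuousOn (fun x => (Real.exp (φ x / 2) * √(ψ x))⁻¹) Ω :=
    hEψ.inv₀ fun x hx => (hpos x hx).ne'
  -- The weights are split so that everything lives in unweighted `L²(Ω)`: `T v = e^{φ/2} Dv`, `S v
  -- = e^{φ/2} √ψ v`, and `⟨F, S v⟩` is the unweighted pairing of `f` with `v`. The solution is `u =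
  -- e^{φ/2} h`, for which `|u|² e^{-φ} = |h|²`.
  set F : Eucl n → Cl n := fun x => (Real.exp (φ x / 2) * √(ψ x))⁻¹ • f x with hF
  have hFm : AEStronglyMeasurable F μ := (hinv.aestronglyMeasurable hmeas).smul hfm
  have hFn : ∀ x ∈ Ω, ‖F x‖ ^ 2 = ‖f x‖ ^ 2 / ψ x * Real.exp (-φ x) := by
    intro x hx
    rw [hF]
    simp only
    rw [norm_smul, mul_pow, Real.norm_eq_abs, sq_abs, inv_pow, mul_pow, hE2,
      Real.sq_sqrt (hψ0 x hx).le, Real.exp_neg, mul_inv]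
    ring
  have hFint : ∫⁻ x, ENNReal.ofReal (‖F x‖ ^ 2) ∂μ = wInt Ω φ (fun x => ‖f x‖ ^ 2 / ψ x) :=
    setLIntegral_congr_fun hmeas fun x hx => by simp only [hFn x hx]
  have hFL : MemLp F 2 μ := memLp_two_of_lintegral_lt_top hFm (by rw [hFint]; exact hf)
  have hFnorm : ENNReal.ofReal (‖hFL.toLp‖ ^ 2) = wInt Ω φ (fun x => ‖f x‖ ^ 2 / ψ x) := by
    rw [ofReal_norm_sq_eq_lintegral, ← hFint]
    refine lintegral_congr_ae ?_
    filter_upwards [hFL.coeFn_toLp] with x hx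
    rw [hx]
  obtain ⟨h, hh1, hh2⟩ := exists_inner_map_eq_inner_map (testMul hΩ hEψ)
    (testMul hΩ hE ∘ₗ testDirac Ω) (fun v => by
      rw [← sq_le_sq₀ (norm_nonneg _) (norm_nonneg _), LinearMap.comp_apply, norm_testMul_sq,
        norm_testMul_sq]
      simp only [hE2]
      refine le_trans (le_of_eq ?_) (hest v.1 v.2)
      refine integral_congr_ae (Filter.Eventually.of_forall fun x => ?_)
      simp only
      by_cases hx : x ∈ Ω
      · rw [mul_pow, hE2, Real.sq_sqrt (hψ0 x hx).le]; ring
      · rw [v.2.eq_zero hx]; simp) hFL.toLp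
  have hloc : ∀ {G : Eucl n → Cl n}, MemLp G 2 μ → LocallyIntegrableOn G Ω := fun hG =>
    locallyIntegrableOn_of_locallyIntegrable_restrict (hG.locallyIntegrable (by norm_num))
  have hun : ∀ x, ‖Real.exp (φ x / 2) • h x‖ ^ 2 * Real.exp (-φ x) = ‖h x‖ ^ 2 := by
    intro x
    rw [norm_smul, mul_pow, Real.norm_eq_abs, sq_abs, hE2, Real.exp_neg]
    field_simp
  have hle : wNormSq Ω φ (fun x => Real.exp (φ x / 2) • h x) ≤
      wInt Ω φ (fun x => ‖f x‖ ^ 2 / ψ x) := by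
    have h1 : wNormSq Ω φ (fun x => Real.exp (φ x / 2) • h x) = ENNReal.ofReal (‖h‖ ^ 2) := by
      rw [ofReal_norm_sq_eq_lintegral, wNormSq, wInt]
      simp only [hun]
    rw [h1, ← hFnorm]
    gcongr
  refine ⟨fun x => Real.exp (φ x / 2) • h x, ⟨?_, hle.trans_lt hf⟩, ⟨?_, ?_, ?_⟩, hle⟩
  · exact (hE.aestronglyMeasurable hmeas).smul (Lp.aestronglyMeasurable h)
  · exact (hloc (Lp.memLp h)).continuousOn_smul hΩ.isLocallyClosed hE
  · refine ((hloc hFL).continuousOn_smul hΩ.isLocallyClosed hEψ).congr ?_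
    refine (ae_restrict_mem hmeas).mono fun x hx => ?_
    simp only [hF]
    rw [smul_inv_smul₀ (hpos x hx).ne']
  · intro v hv1 hv2 hv3
    have := hh2 ⟨v, hv1, hv2, hv3⟩
    rw [L2.inner_def, L2.inner_def] at this
    convert this.symm using 1
    · refine integral_congr_ae ?_
      filter_upwards [hFL.coeFn_toLp, coeFn_testMul hΩ hEψ ⟨v, hv1, hv2, hv3⟩,
        ae_restrict_mem hmeas] with x h1 h2 hx
      rw [h1, h2, hF, inner_smul_left, inner_smul_right, ← mul_assoc]
      simp only [conj_trivial]
      rw [inv_mul_cancel₀ (hpos x hx).ne', one_mul]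
    · refine integral_congr_ae ?_
      filter_upwards [coeFn_testMul hΩ hE (testDirac Ω ⟨v, hv1, hv2, hv3⟩)] with x h1
      rw [LinearMap.comp_apply, h1, inner_smul_left, inner_smul_right]
      simp only [conj_trivial]
      rfl

end

/-! ### Conjugation by the weight, and size of the defect -/

noncomputable section

open MeasureTheory

variable {n : ℕ} {Ω : Set (Eucl n)} {g : Eucl n → Cl n} {α β : Fin n → ℝ}

theorem affineSq_nonneg (x : Eucl n) : 0 ≤ affineSq α β x := Finset.sum_nonneg fun _ _ => sq_nonneg _

/-- Conjugation of the Dirac operator by `e^{φ/2}` when `∇φ` is parallel to the affine field. -/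
theorem exists_twist_eq (hΩ : IsOpen Ω) {φ k : Eucl n → ℝ} (hφ : ContDiffOn ℝ ∞ φ Ω)
    (hs : ∀ x ∈ Ω, affineSq α β x ≠ 0)
    (hgrad : ∀ x ∈ Ω, gradVec φ x = k x • affineField α β x) {v : Eucl n → Cl n}
    (hv : IsTest Ω v) :
    ∃ g, IsTest Ω g ∧ (∀ x, twist α β g x = Real.exp (φ x / 2) • v x) ∧
      ∀ x, Real.exp (φ x) * ‖diracOp v x‖ ^ 2 = ‖diracOp (twist α β g) x -
        (k x / 2) • (Cl.vec (affineField α β x) * twist α β g x)‖ ^ 2 := by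
  have hE : ContDiffOn ℝ ∞ (fun x => Real.exp (φ x / 2)) Ω := (hφ.div_const 2).exp
  have hh : ContDiffOn ℝ ∞ (fun x => Real.exp (φ x / 2) / affineSq α β x) Ω :=
    hE.div (contDiff_affineSq α β).contDiffOn hs
  -- This solves `-c g = e^{φ/2} v`, because `c⁻¹ = -c / |c|²`.
  refine ⟨fun x => (Real.exp (φ x / 2) / affineSq α β x) • (Cl.vec (affineField α β x) * v x),
    (hv.vec_mul hΩ fun j => (contDiff_affineField α β j).contDiffOn).smul hΩ hh, ?_⟩
  set g := fun x => (Real.exp (φ x / 2) / affineSq α β x) •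
    (Cl.vec (affineField α β x) * v x) with hg
  have htw : ∀ x, twist α β g x = Real.exp (φ x / 2) • v x := by
    intro x
    by_cases hx : x ∈ Ω
    · rw [twist, hg]
      simp only
      rw [mul_smul_comm, Cl.vec_mul_vec_mul, smul_neg, neg_neg, smul_smul]
      change (_ * affineSq α β x) • _ = _
      rw [div_mul_cancel₀ _ (hs x hx)]
    · rw [twist, hg]
      simp [hv.eq_zero hx]
  refine ⟨htw, fun x => ?_⟩
  have htw' : twist α β g = fun x => Real.exp (φ x / 2) • v x := funext htw
  rw [htw']
  by_cases hx : x ∈ Ω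
  · have hdφ : DifferentiableAt ℝ φ x :=
      ((hφ x hx).contDiffAt (hΩ.mem_nhds hx)).differentiableAt (by simp)
    have h1 : HasFDerivAt (fun x => Real.exp (φ x / 2))
        (Real.exp (φ x / 2) • ((1 / 2 : ℝ) • fderiv ℝ φ x)) x := by
      have := (hdφ.hasFDerivAt.const_mul (1 / 2)).exp
      simpa only [one_div, inv_mul_eq_div] using this
    have hgE : gradVec (fun x => Real.exp (φ x / 2)) x =
        (Real.exp (φ x / 2) * (k x / 2)) • affineField α β x := by
      ext j
      have h2 := congrFun (hgrad x hx) j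
      simp only [gradVec, pd, Pi.smul_apply, smul_eq_mul] at h2 ⊢
      rw [h1.fderiv]
      simp only [smul_apply, smul_eq_mul]
      rw [h2]; ring
    rw [diracOp_smul h1.differentiableAt (hv.differentiable x), hgE, Cl.vec_smul, smul_mul_assoc, mul_smul_comm,
      smul_smul, mul_comm (k x / 2), add_sub_cancel_right, norm_smul, mul_pow, Real.norm_eq_abs,
      sq_abs, ← Real.exp_nat_mul]
    congr 2
    push_cast; ring
  · have h1 : IsTest Ω (fun x => Real.exp (φ x / 2) • v x) := hv.smul hΩ hE
    rw [hv.diracOp.eq_zero hx, h1.diracOp.eq_zero hx]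
    simp [hv.eq_zero hx]

theorem twistDefect_zero (g : Eucl n → Cl n) (x : Eucl n) : twistDefect 0 β g x = 0 := by
  simp [twistDefect, Cl.vec]

/-- This pointwise identity makes the two halves of the defect cancel when every `αⱼ` is `1`. -/
theorem inner_diracOp_field_mul (g : Eucl n → Cl n) (x : Eucl n) :
    inner ℝ (diracOp g x) (Cl.vec (affineField α β x) * g x) =
      ∑ j, inner ℝ (pd j g x) (Cl.e j * twist α β g x) := by
  have h : Cl.vec (affineField α β x) * g x = -twist α β g x := by rw [twist, neg_neg]
  rw [h, inner_neg_right, diracOp_eq, sum_inner, ← Finset.sum_neg_distrib]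
  simp only [Cl.inner_e_mul, neg_neg]

theorem twistDefect_one (g : Eucl n → Cl n) (x : Eucl n) : twistDefect 1 β g x = 0 := by
  have h := inner_diracOp_field_mul (α := 1) (β := β) g x
  simp only [twistDefect, Pi.one_apply, one_mul]
  rw [← h, sub_self]

/-- Subtracting the cancelling `α = 1` part replaces `αⱼ` by `αⱼ - 1` as coefficient in both halves;
Cauchy–Schwarz and `2ab ≤ a² + b²` do the rest. The factor `n + 1` counts one `|w|²` from the first
half and one for each coordinate from the second. -/
theorem le_twistDefect {ε : ℝ} (hα : ∀ j, |α j - 1| ≤ ε) (g : Eucl n → Cl n)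
    (x : Eucl n) :
    -(ε * (‖diracOp g x‖ ^ 2 + ∑ j, ‖pd j g x‖ ^ 2 + (n + 1) * ‖twist α β g x‖ ^ 2)) ≤
      twistDefect α β g x := by
  have h := inner_diracOp_field_mul (α := α) (β := β) g x
  have hsplit : Cl.vec (fun j => α j * affineField α β x j) =
      Cl.vec (affineField α β x) + Cl.vec (fun j => (α j - 1) * affineField α β x j) := by
    rw [← Cl.vec_add]
    congr 1
    ext j
    simp only [Pi.add_apply]; ring
  have h1 : twistDefect α β g x =
      2 * inner ℝ (diracOp g x) (Cl.vec (fun j => (α j - 1) * affineField α β x j) * g x) -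
      2 * ∑ j, (α j - 1) * inner ℝ (pd j g x) (Cl.e j * twist α β g x) := by
    simp only [twistDefect, hsplit, add_mul, inner_add_right, h, sub_mul,
      Finset.sum_sub_distrib, one_mul]
    ring
  have hyoung : ∀ a b : ℝ, 2 * (a * b) ≤ a ^ 2 + b ^ 2 := fun a b => by
    nlinarith [sq_nonneg (a - b)]
  have h2 : |2 * inner ℝ (diracOp g x)
      (Cl.vec (fun j => (α j - 1) * affineField α β x j) * g x)| ≤
      ε * (‖diracOp g x‖ ^ 2 + ‖twist α β g x‖ ^ 2) := by
    -- In dimension zero the hypothesis does not make `ε` nonnegative, but both sides vanish.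
    by_cases hn : Nonempty (Fin n)
    · have hε : 0 ≤ ε := (abs_nonneg _).trans (hα hn.some)
      have h3 : ‖Cl.vec (fun j => (α j - 1) * affineField α β x j) * g x‖ ≤
          ε * ‖twist α β g x‖ := by
        rw [← sq_le_sq₀ (norm_nonneg _) (by positivity), Cl.norm_vec_mul_sq, mul_pow,
          norm_twist_sq, ← mul_assoc, affineSq, Finset.mul_sum]
        gcongr with j _
        rw [mul_pow]
        refine mul_le_mul_of_nonneg_right ?_ (sq_nonneg _)
        rw [← sq_abs]
        exact pow_le_pow_left₀ (abs_nonneg _) (hα j) 2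
      rw [abs_mul, abs_two]
      calc 2 * |inner ℝ (diracOp g x)
            (Cl.vec (fun j => (α j - 1) * affineField α β x j) * g x)| ≤
          2 * (‖diracOp g x‖ * (ε * ‖twist α β g x‖)) := by
            gcongr
            exact (abs_real_inner_le_norm _ _).trans (by gcongr)
        _ = ε * (2 * (‖diracOp g x‖ * ‖twist α β g x‖)) := by ring
        _ ≤ _ := by gcongr; exact hyoung _ _
    · rw [not_nonempty_iff] at hn
      have : diracOp g x = 0 := by simp [diracOp]
      have h4 : twist α β g x = 0 := by simp [twist, Cl.vec]
      simp [this, h4]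
  have h3 : |2 * ∑ j, (α j - 1) * inner ℝ (pd j g x) (Cl.e j * twist α β g x)| ≤
      ε * (∑ j, ‖pd j g x‖ ^ 2 + n * ‖twist α β g x‖ ^ 2) := by
    rw [abs_mul, abs_two]
    calc 2 * |∑ j, (α j - 1) * inner ℝ (pd j g x) (Cl.e j * twist α β g x)| ≤
        2 * ∑ j, |(α j - 1) * inner ℝ (pd j g x) (Cl.e j * twist α β g x)| := by
          gcongr
          exact Finset.abs_sum_le_sum_abs _ _
      _ ≤ 2 * ∑ j, ε * (‖pd j g x‖ * ‖twist α β g x‖) := by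
          gcongr with j _
          rw [abs_mul]
          have hε : 0 ≤ ε := (abs_nonneg _).trans (hα j)
          gcongr
          · exact hα j
          · exact (abs_real_inner_le_norm _ _).trans (by rw [Cl.norm_e_mul])
      _ = ∑ j, ε * (2 * (‖pd j g x‖ * ‖twist α β g x‖)) := by
          rw [Finset.mul_sum]; exact Finset.sum_congr rfl fun j _ => by ring
      _ ≤ ∑ j, ε * (‖pd j g x‖ ^ 2 + ‖twist α β g x‖ ^ 2) := by
          refine Finset.sum_le_sum fun j _ => ?_
          have hε : 0 ≤ ε := (abs_nonneg _).trans (hα j)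
          gcongr
          exact hyoung _ _
      _ = _ := by
          rw [← Finset.mul_sum, Finset.sum_add_distrib]; simp
  rw [h1]
  have h4 := (abs_le.1 h2).1
  have h5 := (abs_le.1 h3).2
  nlinarith

end

/-! ### The three a priori estimates -/

noncomputable section

open MeasureTheory

variable {n : ℕ} {Ω : Set (Eucl n)} {g : Eucl n → Cl n} {α β : Fin n → ℝ}

theorem gradVec_comp {h : Eucl n → ℝ} {F : ℝ → ℝ} {F' : ℝ} {x : Eucl n}
    (hh : DifferentiableAt ℝ h x) (hF : HasDerivAt F F' (h x)) :
    gradVec (fun y => F (h y)) x = F' • gradVec h x := by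
  ext j
  simp only [gradVec, pd]
  have := (hF.comp_hasFDerivAt x hh.hasFDerivAt).fderiv
  change (fderiv ℝ (F ∘ h) x) _ = _
  rw [this]; rfl

theorem differentiable_affineSq (x : Eucl n) : DifferentiableAt ℝ (affineSq α β) x :=
  (contDiff_affineSq α β).differentiable (by simp) x

theorem affineField_one_zero (x : Eucl n) : affineField 1 0 x = fun j => x j := by
  ext j; simp [affineField]

theorem affineSq_one_zero (x : Eucl n) : affineSq 1 0 x = ‖x‖ ^ 2 := by
  simp [affineSq, affineField_one_zero, EuclideanSpace.norm_sq_eq]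

theorem affineSq_one_zero_rpow (m : ℝ) (x : Eucl n) : affineSq 1 0 x ^ (m / 2) = ‖x‖ ^ m := by
  rw [affineSq_one_zero, ← Real.rpow_natCast, ← Real.rpow_mul (norm_nonneg _)]
  congr 1
  push_cast; ring

/-- A priori estimate for the weight `|x|^m`. -/
theorem radial_estimate (m : ℝ) (hΩ : IsOpen Ω) (h0 : Ω ⊆ {0}ᶜ) {v : Eucl n → Cl n}
    (hv : IsTest Ω v) :
    ∫ x, m ^ 2 * ‖x‖ ^ (m - 2) * Real.exp (‖x‖ ^ m) * ‖v x‖ ^ 2 ≤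
      ∫ x, Real.exp (‖x‖ ^ m) * ‖diracOp v x‖ ^ 2 := by
  have hs : ∀ x ∈ Ω, 0 < affineSq (n := n) 1 0 x := fun x hx => by
    rw [affineSq_one_zero]
    have : x ≠ 0 := h0 hx
    positivity
  -- With `c = x` and `s = |x|²` this is `k = m |x|^(m-2)`. Then `s k = m |x|^m` and `c · ∇(s k) =
  -- m² |x|^m`, which against `|g|² = |w|² / |x|²` gives `m² |x|^(m-2) |w|²`.
  set k : Eucl n → ℝ := fun x => m * affineSq 1 0 x ^ (m / 2 - 1) with hk
  have hkc : ContDiffOn ℝ ∞ k Ω := contDiffOn_const.mul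
    ((contDiff_affineSq 1 0).contDiffOn.rpow_const_of_ne fun x hx => (hs x hx).ne')
  have hφc : ContDiffOn ℝ ∞ (fun x : Eucl n => affineSq 1 0 x ^ (m / 2)) Ω :=
    (contDiff_affineSq 1 0).contDiffOn.rpow_const_of_ne fun x hx => (hs x hx).ne'
  have hgs : ∀ x : Eucl n, gradVec (affineSq 1 0) x = (2 : ℝ) • affineField 1 0 x := fun x => by
    rw [gradVec_affineSq]; simp
  obtain ⟨g, hg, hw, hD⟩ := exists_twist_eq (α := 1) (β := 0) (k := k) hΩ hφc
    (fun x hx => (hs x hx).ne') (fun x hx => by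
      rw [gradVec_comp (F := fun t => t ^ (m / 2)) (differentiable_affineSq x)
        (Real.hasDerivAt_rpow_const (Or.inl (hs x hx).ne')), hgs, smul_smul]
      congr 1
      simp only [hk]; ring) hv
  have hmain := integral_norm_sq_weighted (α := 1) (β := 0) hg hΩ hkc
  simp only [← hD, twistDefect_one, integral_zero, add_zero, affineSq_one_zero_rpow] at hmain
  rw [hmain]
  have hP : 0 ≤ ∫ x, affineSq 1 0 x * ‖diracOp g x - (k x / 2) • twist 1 0 g x‖ ^ 2 :=
    integral_nonneg fun x => mul_nonneg (affineSq_nonneg x) (sq_nonneg _)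
  refine le_trans (le_of_eq ?_) (le_add_of_nonneg_left hP)
  refine integral_congr_ae (Filter.Eventually.of_forall fun x => ?_)
  simp only
  by_cases hx : x ∈ Ω
  · have hsx := hs x hx
    have e1 : ‖twist 1 0 g x‖ ^ 2 = Real.exp (‖x‖ ^ m) * ‖v x‖ ^ 2 := by
      rw [hw, norm_smul, mul_pow, Real.norm_eq_abs, sq_abs, ← Real.exp_nat_mul,
        affineSq_one_zero_rpow]
      congr 2
      push_cast; ring
    have e2 : gradVec (fun y => affineSq 1 0 y * k y) x =
        (m ^ 2 / 2 * affineSq 1 0 x ^ (m / 2 - 1)) • gradVec (affineSq 1 0) x := by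
      refine gradVec_comp (F := fun t => t * (m * t ^ (m / 2 - 1))) (differentiable_affineSq x) ?_
      have h1 := (hasDerivAt_id (affineSq 1 0 x)).mul ((Real.hasDerivAt_rpow_const
        (p := m / 2 - 1) (Or.inl hsx.ne')).const_mul m)
      refine HasDerivAt.congr_deriv h1 ?_
      rw [Real.rpow_sub_one hsx.ne' (m / 2 - 1)]
      simp only [id]
      field_simp
      ring
    have e3 : ∑ j, affineField 1 0 x j * gradVec (fun y => affineSq 1 0 y * k y) x j =
        m ^ 2 * affineSq 1 0 x ^ (m / 2 - 1) * affineSq 1 0 x := by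
      rw [e2, hgs, affineSq, Finset.mul_sum]
      refine Finset.sum_congr rfl fun j _ => ?_
      simp only [Pi.smul_apply, smul_eq_mul]; ring
    have e4 : affineSq 1 0 x ^ (m / 2 - 1) = ‖x‖ ^ (m - 2) := by
      rw [← affineSq_one_zero_rpow]; congr 1; ring
    rw [mul_assoc, ← e1, e3, norm_twist_sq, e4]; ring
  · rw [hv.eq_zero hx, hg.eq_zero hx]; simp

/-- A priori estimate for the weight `x_i²`. -/
theorem coordinate_estimate (i : Fin n) (hΩ : IsOpen Ω) {v : Eucl n → Cl n} (hv : IsTest Ω v) :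
    ∫ x, 2 * Real.exp (x i ^ 2) * ‖v x‖ ^ 2 ≤ ∫ x, Real.exp (x i ^ 2) * ‖diracOp v x‖ ^ 2 := by
  -- The constant unit field: `s = 1`, `k = 2 xᵢ`, hence `c · ∇(s k) = 2`.
  set c : Fin n → ℝ := Pi.single i 1 with hc
  have hf : ∀ x : Eucl n, affineField 0 c x = c := fun x => by ext j; simp [affineField]
  have hs : ∀ x : Eucl n, affineSq 0 c x = 1 := fun x => by
    simp only [affineSq, hf]
    rw [Finset.sum_eq_single i] <;> simp +contextual [hc]
  have hcoord : ∀ x : Eucl n, DifferentiableAt ℝ (fun y : Eucl n => y i) x := fun x =>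
    (EuclideanSpace.proj (𝕜 := ℝ) i).differentiableAt
  have hgc : ∀ x : Eucl n, gradVec (fun y : Eucl n => y i) x = c := fun x => by
    ext j
    have := pd_affineField 1 0 j i x
    simp only [affineField_one_zero] at this
    rw [gradVec, this, hc]
    simp [Pi.single_apply, eq_comm]
  have hkc : ContDiff ℝ ∞ (fun x : Eucl n => 2 * x i) := by fun_prop
  have hφc : ContDiff ℝ ∞ (fun x : Eucl n => x i ^ 2) := by fun_prop
  obtain ⟨g, hg, hw, hD⟩ := exists_twist_eq (α := 0) (β := c) (k := fun x => 2 * x i) hΩ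
    hφc.contDiffOn (fun x _ => by rw [hs]; exact one_ne_zero) (fun x _ => by
      rw [gradVec_comp (F := fun t => t ^ 2) (hcoord x) (hasDerivAt_pow 2 _), hgc, hf]
      simp) hv
  have hmain := integral_norm_sq_weighted (α := 0) (β := c) hg hΩ hkc.contDiffOn
  simp only [← hD, twistDefect_zero, integral_zero, add_zero] at hmain
  rw [hmain]
  have hP : 0 ≤ ∫ x, affineSq 0 c x * ‖diracOp g x - (2 * x i / 2) • twist 0 c g x‖ ^ 2 :=
    integral_nonneg fun x => mul_nonneg (affineSq_nonneg x) (sq_nonneg _)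
  refine le_trans (le_of_eq ?_) (le_add_of_nonneg_left hP)
  refine integral_congr_ae (Filter.Eventually.of_forall fun x => ?_)
  simp only
  have e1 : ‖g x‖ ^ 2 = Real.exp (x i ^ 2) * ‖v x‖ ^ 2 := by
    rw [← one_mul (‖g x‖ ^ 2), ← hs x, ← norm_twist_sq, hw, norm_smul, mul_pow,
      Real.norm_eq_abs, sq_abs, ← Real.exp_nat_mul]
    congr 2
    push_cast; ring
  have e2 : gradVec (fun y => affineSq 0 c y * (2 * y i)) x = (2 : ℝ) • c := by
    simp only [hs, one_mul]
    rw [gradVec_comp (F := fun t => 2 * t) (hcoord x)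
      (by simpa using (hasDerivAt_id (x i)).const_mul 2), hgc]
  have e3 : ∑ j, affineField 0 c x j * gradVec (fun y => affineSq 0 c y * (2 * y i)) x j = 2 := by
    rw [e2, hf, Finset.sum_eq_single i] <;> simp +contextual [hc]
  rw [mul_assoc, ← e1, e3]

/-- A priori estimate for the weights `∑ aᵢ xᵢ²` with `aᵢ` close to `1`, away from the origin. -/
theorem perturbed_estimate {a : Fin n → ℝ} (ha : ∀ i, |a i - 1| ≤ 1 / (n + 9)) (hΩ : IsOpen Ω)
    (h0 : Ω ⊆ (Metric.closedBall 0 1)ᶜ) {v : Eucl n → Cl n} (hv : IsTest Ω v) :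
    ∫ x, 3 * Real.exp (∑ i, a i * x i ^ 2) * ‖v x‖ ^ 2 ≤
      ∫ x, Real.exp (∑ i, a i * x i ^ 2) * ‖diracOp v x‖ ^ 2 := by
  set ε : ℝ := 1 / (n + 9) with hε
  have hε0 : 0 < ε := by positivity
  have hεn : ε * (n + 9) = 1 := by rw [hε]; field_simp
  have hε9 : ε * 9 ≤ 1 := by nlinarith [(Nat.cast_nonneg n : (0:ℝ) ≤ n)]
  have ha1 : ∀ i, 1 - ε ≤ a i := fun i => by have := (abs_le.1 (ha i)).1; linarith
  have hapos : ∀ i, 0 ≤ a i := fun i => by have := ha1 i; linarith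
  -- This is where staying outside the unit ball matters: `ε ≤ 1/9` gives `s ≥ (8/9)² |x|² > 1/2`.
  have hs : ∀ x ∈ Ω, 1 / 2 ≤ affineSq a 0 x := by
    intro x hx
    have hx1 : 1 ≤ ‖x‖ ^ 2 := by
      have : ¬ ‖x‖ ≤ 1 := fun h => h0 hx (by simpa using h)
      nlinarith
    have h1 : (1 - ε) ^ 2 * ‖x‖ ^ 2 ≤ affineSq a 0 x := by
      rw [EuclideanSpace.norm_sq_eq, Finset.mul_sum, affineSq]
      refine Finset.sum_le_sum fun j _ => ?_
      simp only [affineField, Pi.zero_apply, add_zero, mul_pow, Real.norm_eq_abs, sq_abs]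
      have := ha1 j
      have h2 : 0 ≤ 1 - ε := by linarith
      gcongr
    nlinarith
  -- The weight is itself the squared length of the field `√aᵢ xᵢ`, so `gradVec_affineSq` yields `∇φ
  -- = 2 c` with `c = (aᵢ xᵢ)`.
  set b : Fin n → ℝ := fun i => √(a i) with hb
  have hφ : ∀ x : Eucl n, affineSq b 0 x = ∑ i, a i * x i ^ 2 := fun x => by
    refine Finset.sum_congr rfl fun i _ => ?_
    simp [affineField, hb, mul_pow, Real.sq_sqrt (hapos i)]
  obtain ⟨g, hg, hw, hD⟩ := exists_twist_eq (α := a) (β := 0) (k := fun _ => 2) hΩ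
    (contDiff_affineSq b 0).contDiffOn (fun x hx => by have := hs x hx; linarith) (fun x _ => by
      rw [gradVec_affineSq]
      ext j
      simp only [Pi.smul_apply, affineField, hb, Pi.zero_apply, add_zero, smul_eq_mul]
      rw [← mul_assoc (√(a j)), Real.mul_self_sqrt (hapos j)]) hv
  simp only [hφ] at hw hD
  have hmain := integral_norm_sq_weighted (α := a) (β := 0) hg hΩ (k := fun _ => 2)
    contDiffOn_const
  simp only [← hD] at hmain
  rw [hmain]
  have hwt := hg.twist a 0 hΩ
  set w := twist a 0 g with hwdef
  set P := ∫ x, affineSq a 0 x * ‖diracOp g x - ((2 : ℝ) / 2) • w x‖ ^ 2 with hP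
  set W := ∫ x, ‖w x‖ ^ 2 with hW
  set G := ∫ x, ‖diracOp g x‖ ^ 2 with hG
  have iW : Integrable fun x => ‖w x‖ ^ 2 := hwt.integrable_sq
  have iG : Integrable fun x => ‖diracOp g x‖ ^ 2 := hg.diracOp.integrable_sq
  have hdiff : IsTest Ω fun x => diracOp g x - ((2 : ℝ) / 2) • w x := by
    simpa only [sub_eq_add_neg, neg_smul, ← neg_smul] using
      hg.diracOp.add (hwt.const_smul (-((2 : ℝ) / 2)))
  have iP : Integrable fun x => affineSq a 0 x * ‖diracOp g x - ((2 : ℝ) / 2) • w x‖ ^ 2 := by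
    have := hdiff.integrable_inner (hdiff.smul hΩ (contDiff_affineSq a 0).contDiffOn)
    simpa only [inner_smul_right, real_inner_self_eq_norm_sq] using this
  have e1 : ∀ x, ‖w x‖ ^ 2 = Real.exp (∑ i, a i * x i ^ 2) * ‖v x‖ ^ 2 := fun x => by
    rw [hw, norm_smul, mul_pow, Real.norm_eq_abs, sq_abs, ← Real.exp_nat_mul]
    congr 2
    push_cast; ring
  have hL : ∫ x, 3 * Real.exp (∑ i, a i * x i ^ 2) * ‖v x‖ ^ 2 = 3 * W := by
    rw [hW, ← integral_const_mul]
    simp only [e1, mul_assoc]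
  -- From `|Dg|² ≤ 2 |Dg - w|² + 2 |w|²` and `1 ≤ 2 s` on `Ω`.
  have hGP : G ≤ 4 * P + 2 * W := by
    rw [hG, hP, hW, ← integral_const_mul, ← integral_const_mul, ← integral_add
      (iP.const_mul 4) (iW.const_mul 2)]
    refine integral_mono iG ((iP.const_mul 4).add (iW.const_mul 2)) fun x => ?_
    by_cases hx : x ∈ Ω
    · have h1 := hs x hx
      have h2 : ‖diracOp g x‖ ^ 2 ≤
          2 * ‖diracOp g x - ((2 : ℝ) / 2) • w x‖ ^ 2 + 2 * ‖w x‖ ^ 2 := by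
        have h3 : diracOp g x = (diracOp g x - ((2 : ℝ) / 2) • w x) + w x := by
          rw [div_self two_ne_zero, one_smul, sub_add_cancel]
        have h4 := norm_add_le (diracOp g x - ((2 : ℝ) / 2) • w x) (w x)
        rw [← h3] at h4
        have h5 := norm_nonneg (diracOp g x)
        nlinarith [sq_nonneg (‖diracOp g x - ((2 : ℝ) / 2) • w x‖ - ‖w x‖)]
      nlinarith [sq_nonneg ‖diracOp g x - ((2 : ℝ) / 2) • w x‖]
    · rw [hg.diracOp.eq_zero hx, hwt.eq_zero hx]; simp
  -- The full gradient in the defect bound costs no more than `Dg`, because `D² = -Δ`.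
  have hpd : ∫ x, ∑ j, ‖pd j g x‖ ^ 2 = G := by
    have := integral_inner_diracOp_diracOp hg hg
    simp only [real_inner_self_eq_norm_sq] at this
    exact this.symm
  have iS : Integrable fun x => ∑ j, ‖pd j g x‖ ^ 2 :=
    integrable_finsetSum _ fun j _ => (hg.pd j).integrable_sq
  have hdef : -(ε * (2 * G + (n + 1) * W)) ≤ ∫ x, twistDefect a 0 g x := by
    have h1 : -(ε * (2 * G + (n + 1) * W)) = ∫ x, -(ε * (‖diracOp g x‖ ^ 2 +
        ∑ j, ‖pd j g x‖ ^ 2 + (n + 1) * ‖w x‖ ^ 2)) := by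
      rw [integral_neg, integral_const_mul, integral_add (iG.fun_add iS) (iW.const_mul _),
        integral_add iG iS, integral_const_mul, hpd]
      ring
    rw [h1]
    exact integral_mono (((iG.add iS).add (iW.const_mul _)).const_mul ε).neg
      (integrable_twistDefect hg hΩ) fun x => le_twistDefect ha g x
  -- Here `c · ∇(2 s) = 4 ∑ aⱼ cⱼ² ≥ 4 (1 - ε) s`.
  have hZ : 4 * (1 - ε) * W ≤
      ∫ x, (∑ j, affineField a 0 x j * gradVec (fun y => affineSq a 0 y * 2) x j) *
        ‖g x‖ ^ 2 := by
    have e2 : ∀ x : Eucl n, (∑ j, affineField a 0 x j *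
        gradVec (fun y => affineSq a 0 y * 2) x j) =
        ∑ j, 4 * a j * affineField a 0 x j ^ 2 := by
      intro x
      have : gradVec (fun y : Eucl n => affineSq a 0 y * 2) x =
          (2 : ℝ) • gradVec (affineSq a 0) x :=
        gradVec_comp (F := fun t => t * 2) (differentiable_affineSq x)
          (by simpa using (hasDerivAt_id (affineSq a 0 x)).mul_const 2)
      rw [this, gradVec_affineSq]
      refine Finset.sum_congr rfl fun j _ => ?_
      simp only [Pi.smul_apply, smul_eq_mul]; ring
    simp only [e2]
    rw [hW, ← integral_const_mul]
    refine integral_mono (iW.const_mul _) ?_ fun x => ?_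
    · have hc : ContDiff ℝ ∞ fun x : Eucl n => ∑ j, 4 * a j * affineField a 0 x j ^ 2 :=
        ContDiff.sum fun j _ => contDiff_const.mul ((contDiff_affineField a 0 j).pow 2)
      have := hg.integrable_inner (hg.smul hΩ hc.contDiffOn)
      simpa only [inner_smul_right, real_inner_self_eq_norm_sq] using this
    · simp only [hwdef]
      rw [norm_twist_sq, ← mul_assoc, affineSq, Finset.mul_sum]
      gcongr with j _
      exact ha1 j
  rw [hL]
  -- Altogether the energy is at least `(1 - 8ε) P + (4 - (n + 9) ε) W`, where `n + 9 = 4 + 4 + (n +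
  -- 1)` collects the losses in `hZ`, in `2G` and in the defect. Since `ε = 1/(n + 9)`, this is at
  -- least `3 W`.
  have hP0 : 0 ≤ P := integral_nonneg fun x => mul_nonneg (affineSq_nonneg x) (sq_nonneg _)
  have h1 : ε * G ≤ ε * (4 * P + 2 * W) := by gcongr
  have h2 : ε * 9 * P ≤ P := by nlinarith
  have h3 : ε * (n + 9) * W = W := by rw [hεn, one_mul]
  have h4 : 0 ≤ ε * P := by positivity
  nlinarith

end

/-! ### Converse duality -/

noncomputable section

open MeasureTheory

variable {n : ℕ} {Ω : Set (Eucl n)}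

/-- Solvability of `Du = f` with a norm bound implies the dual estimate on test functions. -/
theorem integral_le_of_solvable (hΩ : IsOpen Ω) {φ : Eucl n → ℝ} (hφ : Continuous φ) {C : ℝ}
    (hC : 0 ≤ C)
    (H : ∀ f : Eucl n → Cl n, MemL2 Ω φ f → ∃ u : Eucl n → Cl n, MemL2 Ω φ u ∧ DiracEq Ω u f ∧
      wNormSq Ω φ u ≤ ENNReal.ofReal C * wNormSq Ω φ f)
    {v : Eucl n → Cl n} (hv : IsTest Ω v) :
    ∫ x, Real.exp (φ x) * ‖v x‖ ^ 2 ≤ C * ∫ x, Real.exp (φ x) * ‖diracOp v x‖ ^ 2 := by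
  have hmeas : MeasurableSet Ω := hΩ.measurableSet
  set A := ∫ x, Real.exp (φ x) * ‖v x‖ ^ 2 with hA
  set B := ∫ x, Real.exp (φ x) * ‖diracOp v x‖ ^ 2 with hB
  have hA0 : 0 ≤ A := integral_nonneg fun x => by positivity
  have hB0 : 0 ≤ B := integral_nonneg fun x => by positivity
  have hE2 : ∀ x, Real.exp (φ x / 2) ^ 2 = Real.exp (φ x) := fun x => by
    rw [← Real.exp_nat_mul]; congr 1; push_cast; ring
  have hE : ContinuousOn (fun x => Real.exp (φ x / 2)) Ω := (by fun_prop : Continuous _).continuousOn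
  have hAΩ : A = ∫ x in Ω, Real.exp (φ x) * ‖v x‖ ^ 2 := by
    rw [setIntegral_eq_integral_of_forall_compl_eq_zero]
    intro x hx
    rw [hv.eq_zero hx]; simp
  have hint : Integrable (fun x => Real.exp (φ x) * ‖v x‖ ^ 2) := by
    have hc : Continuous (fun x => Real.exp (φ x) * ‖v x‖ ^ 2) := by
      have := hv.continuous
      fun_prop
    exact hc.integrable_of_hasCompactSupport
      (hv.cpt.mono fun x hx h0 => hx (by simp only [h0, norm_zero]; simp))
  -- With this datum both `‖f‖_φ²` and the pairing of `f` with `v` equal `A`. Cauchy–Schwarz on `∫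
  -- ⟨u, Dv⟩` then gives `A² ≤ (C A) B`.
  set f : Eucl n → Cl n := fun x => Real.exp (φ x) • v x with hf
  have hfn : wNormSq Ω φ f = ENNReal.ofReal A := by
    rw [hAΩ, ofReal_integral_eq_lintegral_ofReal hint.restrict
      (Filter.Eventually.of_forall fun x => by positivity), wNormSq, wInt]
    refine lintegral_congr fun x => ?_
    rw [hf]
    simp only
    rw [norm_smul, mul_pow, Real.norm_eq_abs, sq_abs, Real.exp_neg]
    congr 1
    have := Real.exp_pos (φ x)
    field_simp
  have hfc : Continuous f := by
    have := hv.continuous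
    fun_prop
  obtain ⟨u, hu1, hu2, hu3⟩ := H f ⟨hfc.aestronglyMeasurable, by rw [hfn]; exact ENNReal.ofReal_lt_top⟩
  set G : Eucl n → Cl n := fun x => Real.exp (-φ x / 2) • u x with hG
  have hGn : ∀ x, ‖G x‖ ^ 2 = ‖u x‖ ^ 2 * Real.exp (-φ x) := fun x => by
    rw [hG]
    simp only
    rw [norm_smul, mul_pow, Real.norm_eq_abs, sq_abs, ← Real.exp_nat_mul, mul_comm]
    congr 2
    push_cast; ring
  have hGi : ∫⁻ x in Ω, ENNReal.ofReal (‖G x‖ ^ 2) = wNormSq Ω φ u := by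
    simp only [hGn]; rfl
  have hGc : Continuous fun x => Real.exp (-φ x / 2) := by fun_prop
  have hGL : MemLp G 2 (volume.restrict Ω) := memLp_two_of_lintegral_lt_top
    (hGc.aestronglyMeasurable.smul hu1.1) (by rw [hGi]; exact hu1.2)
  have hGnorm : ‖hGL.toLp‖ ^ 2 ≤ C * A := by
    rw [← ENNReal.ofReal_le_ofReal_iff (by positivity), ofReal_norm_sq_eq_lintegral,
      ENNReal.ofReal_mul hC, ← hfn]
    refine le_trans (le_of_eq ?_) hu3
    rw [← hGi]
    refine lintegral_congr_ae ?_
    filter_upwards [hGL.coeFn_toLp] with x hx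
    rw [hx]
  have hVnorm : ‖testMul hΩ hE (testDirac Ω ⟨v, hv⟩)‖ ^ 2 = B := by
    rw [norm_testMul_sq]
    simp only [hE2]
    rfl
  have hpair : inner ℝ hGL.toLp (testMul hΩ hE (testDirac Ω ⟨v, hv⟩)) = A := by
    have h1 := hu2.2.2 v hv.smooth hv.cpt hv.sub
    have h2 : ∫ x in Ω, inner ℝ (f x) (v x) = A := by
      rw [hAΩ]
      refine integral_congr_ae (Filter.Eventually.of_forall fun x => ?_)
      simp only [hf]
      rw [real_inner_smul_left, real_inner_self_eq_norm_sq]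
    rw [← h2, h1, L2.inner_def]
    refine integral_congr_ae ?_
    filter_upwards [hGL.coeFn_toLp, coeFn_testMul hΩ hE (testDirac Ω ⟨v, hv⟩)] with x hx1 hx2
    rw [hx1, hx2, hG]
    simp only
    rw [real_inner_smul_left, real_inner_smul_right, ← mul_assoc, ← Real.exp_add,
      neg_div, neg_add_cancel, Real.exp_zero, one_mul]
    rfl
  have hle : A ^ 2 ≤ C * A * B := by
    have h1 : A ≤ ‖hGL.toLp‖ * ‖testMul hΩ hE (testDirac Ω ⟨v, hv⟩)‖ :=
      hpair ▸ real_inner_le_norm _ _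
    calc A ^ 2 ≤ (‖hGL.toLp‖ * ‖testMul hΩ hE (testDirac Ω ⟨v, hv⟩)‖) ^ 2 := by gcongr
      _ = ‖hGL.toLp‖ ^ 2 * B := by rw [mul_pow, hVnorm]
      _ ≤ C * A * B := by gcongr
  rcases hA0.eq_or_lt with h | h
  · rw [← h]; positivity
  · refine le_of_mul_le_mul_left ?_ h
    nlinarith

/-! ### Shell cutoffs -/

theorem exists_abs_deriv_smoothTransition_le :
    ∃ M, 0 ≤ M ∧ ∀ t, |deriv Real.smoothTransition t| ≤ M := by
  have hc : Continuous (deriv Real.smoothTransition) :=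
    (Real.smoothTransition.contDiff (n := 1)).continuous_deriv le_rfl
  obtain ⟨M, hM⟩ := (isCompact_Icc (a := (-1 : ℝ)) (b := 2)).exists_bound_of_continuousOn
    hc.continuousOn
  have hM0 : 0 ≤ M := (norm_nonneg _).trans (hM 0 (by norm_num))
  refine ⟨M, hM0, fun t => ?_⟩
  by_cases ht : t ∈ Set.Icc (-1 : ℝ) 2
  · exact hM t ht
  · have : deriv Real.smoothTransition t = 0 := by
      rw [Set.mem_Icc, not_and_or, not_le, not_le] at ht
      rcases ht with ht | ht
      · have : Real.smoothTransition =ᶠ[nhds t] fun _ => 0 := by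
          filter_upwards [Iio_mem_nhds ht] with s hs
          exact Real.smoothTransition.zero_of_nonpos (by rw [Set.mem_Iio] at hs; linarith)
        rw [this.deriv_eq, deriv_const]
      · have : Real.smoothTransition =ᶠ[nhds t] fun _ => 1 := by
          filter_upwards [Ioi_mem_nhds ht] with s hs
          exact Real.smoothTransition.one_of_one_le (by rw [Set.mem_Ioi] at hs; linarith)
        rw [this.deriv_eq, deriv_const]
    rw [this, abs_zero]; exact hM0

theorem deriv_smoothTransition_of_one_lt {t : ℝ} (ht : 1 < t) :
    deriv Real.smoothTransition t = 0 := by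
  have : Real.smoothTransition =ᶠ[nhds t] fun _ => 1 := by
    filter_upwards [Ioi_mem_nhds ht] with s hs
    exact Real.smoothTransition.one_of_one_le (le_of_lt hs)
  rw [this.deriv_eq, deriv_const]

/-- A smooth cutoff to the shell `1/(k+2) ≤ t ≤ k+3`. -/
def shellCutoff (k : ℕ) (t : ℝ) : ℝ :=
  Real.smoothTransition ((k + 2) * t - 1) * Real.smoothTransition (k + 3 - t)

theorem contDiff_shellCutoff (k : ℕ) : ContDiff ℝ ∞ (shellCutoff k) :=
  (Real.smoothTransition.contDiff.comp (by fun_prop)).mul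
    (Real.smoothTransition.contDiff.comp (by fun_prop))

theorem shellCutoff_of_le {k : ℕ} {t : ℝ} (ht : (k + 2) * t ≤ 1) : shellCutoff k t = 0 := by
  rw [shellCutoff, Real.smoothTransition.zero_of_nonpos (by linarith), zero_mul]

theorem shellCutoff_of_ge {k : ℕ} {t : ℝ} (ht : k + 3 ≤ t) : shellCutoff k t = 0 := by
  rw [shellCutoff, Real.smoothTransition.zero_of_nonpos (x := k + 3 - t) (by linarith), mul_zero]

theorem shellCutoff_eq_one {k : ℕ} {t : ℝ} (h1 : 1 ≤ t) (h2 : t ≤ 2) : shellCutoff k t = 1 := by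
  have : (0 : ℝ) ≤ k := k.cast_nonneg
  rw [shellCutoff, Real.smoothTransition.one_of_one_le (by nlinarith),
    Real.smoothTransition.one_of_one_le (by linarith), one_mul]

theorem deriv_shellCutoff (k : ℕ) (t : ℝ) : deriv (shellCutoff k) t =
    (k + 2) * deriv Real.smoothTransition ((k + 2) * t - 1) * Real.smoothTransition (k + 3 - t) -
      Real.smoothTransition ((k + 2) * t - 1) * deriv Real.smoothTransition (k + 3 - t) := by
  have hd : ∀ s, HasDerivAt Real.smoothTransition (deriv Real.smoothTransition s) s := fun s =>
    ((Real.smoothTransition.contDiff (n := 1)).differentiable one_ne_zero s).hasDerivAt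
  have h1 : HasDerivAt (fun t : ℝ => (k + 2) * t - 1) (k + 2) t := by
    simpa using ((hasDerivAt_id t).const_mul ((k : ℝ) + 2)).sub_const 1
  have h2 : HasDerivAt (fun t : ℝ => k + 3 - t) (-1) t := by
    simpa using (hasDerivAt_id t).const_sub ((k : ℝ) + 3)
  have h3 := ((hd _).comp t h1).mul ((hd _).comp t h2)
  have h4 : shellCutoff k = (Real.smoothTransition ∘ fun t : ℝ => (k + 2) * t - 1) *
    (Real.smoothTransition ∘ fun t : ℝ => k + 3 - t) := rfl
  rw [h4, h3.deriv]
  simp only [Function.comp]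
  ring

/-- The bound is uniform in `k`: the inner transition has slope of order `k + 2`, but its derivative
vanishes once `(k + 2) t > 2`, so the factor `t` compensates. The outer transition has slope bounded
by `M`. -/
theorem abs_mul_deriv_shellCutoff_le {M : ℝ} (hM : 0 ≤ M)
    (h : ∀ t, |deriv Real.smoothTransition t| ≤ M) (k : ℕ) {t : ℝ} (ht : 0 ≤ t) :
    |t * deriv (shellCutoff k) t| ≤ M * (2 + t) := by
  have hσ : ∀ s, |Real.smoothTransition s| ≤ 1 := fun s => by
    rw [abs_of_nonneg (Real.smoothTransition.nonneg s)]; exact Real.smoothTransition.le_one s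
  have hk : (0 : ℝ) ≤ k := k.cast_nonneg
  have h1 : |t * ((k + 2) * deriv Real.smoothTransition ((k + 2) * t - 1) *
      Real.smoothTransition (k + 3 - t))| ≤ 2 * M := by
    by_cases hkt : (k + 2) * t ≤ 2
    · rw [← mul_assoc, ← mul_assoc, abs_mul, abs_mul, mul_comm t, abs_of_nonneg (by positivity)]
      calc (k + 2) * t * |deriv Real.smoothTransition ((k + 2) * t - 1)| *
            |Real.smoothTransition (k + 3 - t)| ≤ 2 * M * 1 := by
              gcongr
              · exact h _
              · exact hσ _
        _ = 2 * M := mul_one _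
    · rw [deriv_smoothTransition_of_one_lt (by linarith)]
      simp [hM]
  have h2 : |t * (Real.smoothTransition ((k + 2) * t - 1) *
      deriv Real.smoothTransition (k + 3 - t))| ≤ t * (1 * M) := by
    rw [abs_mul, abs_mul, abs_of_nonneg ht]
    gcongr
    · exact hσ _
    · exact h _
  rw [deriv_shellCutoff, mul_sub]
  calc _ ≤ _ := abs_sub _ _
    _ ≤ 2 * M + t * (1 * M) := add_le_add h1 h2
    _ = _ := by ring

theorem eventually_deriv_shellCutoff_eq_zero {t : ℝ} (ht : 0 < t) :
    ∀ᶠ k : ℕ in Filter.atTop, deriv (shellCutoff k) t = 0 := by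
  have h1 : ∀ᶠ k : ℕ in Filter.atTop, 2 / t < (k : ℝ) :=
    tendsto_natCast_atTop_atTop.eventually_gt_atTop _
  have h2 : ∀ᶠ k : ℕ in Filter.atTop, t < (k : ℝ) :=
    tendsto_natCast_atTop_atTop.eventually_gt_atTop _
  filter_upwards [h1, h2] with k hk1 hk2
  rw [div_lt_iff₀ ht] at hk1
  rw [deriv_shellCutoff, deriv_smoothTransition_of_one_lt (by linarith),
    deriv_smoothTransition_of_one_lt (by linarith)]
  ring

end

/-! ### Almost optimal functions for the Gaussian weight -/

noncomputable section

open MeasureTheory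

variable {n : ℕ}

theorem integrable_exp_neg_mul_norm_sq {b : ℝ} (hb : 0 < b) :
    Integrable fun x : Eucl n => Real.exp (-b * ‖x‖ ^ 2) := by
  -- The integral of a non-integrable function is `0` by convention, so the nonzero Gaussian value
  -- proves integrability.
  refine Integrable.of_integral_ne_zero ?_
  rw [GaussianFourier.integral_rexp_neg_mul_sq_norm hb]
  positivity

/-- The scalar profile of the almost optimal test functions for the Gaussian weight. -/
def shellGaussian (k : ℕ) (t : ℝ) : ℝ := Real.exp (-t / 2) * shellCutoff k t

theorem hasDerivAt_shellGaussian (k : ℕ) (t : ℝ) : HasDerivAt (shellGaussian k)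
    (Real.exp (-t / 2) * deriv (shellCutoff k) t - shellGaussian k t / 2) t := by
  have h1 : HasDerivAt (fun t : ℝ => Real.exp (-t / 2)) (Real.exp (-t / 2) * (-1 / 2)) t :=
    (((hasDerivAt_id t).neg).div_const 2).exp
  have h2 : HasDerivAt (shellCutoff k) (deriv (shellCutoff k) t) t :=
    ((contDiff_shellCutoff k).differentiable (by simp) t).hasDerivAt
  refine HasDerivAt.congr_deriv (h1.mul h2) ?_
  rw [shellGaussian]; ring

/-- The almost optimal functions, as multiples of `1`. -/
def shellTest (k : ℕ) (x : Eucl n) : Cl n := shellGaussian k (affineSq 1 0 x) • 1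

theorem isTest_shellTest (k : ℕ) : IsTest {0}ᶜ (shellTest (n := n) k) := by
  have hk : (0 : ℝ) ≤ k := k.cast_nonneg
  have hcont : Continuous (affineSq (n := n) 1 0) := (contDiff_affineSq 1 0).continuous
  have hsmooth : ContDiff ℝ ∞ (shellTest (n := n) k) := by
    have h1 : ContDiff ℝ ∞ (shellGaussian k) :=
      (by fun_prop : ContDiff ℝ ∞ fun t : ℝ => Real.exp (-t / 2)).mul (contDiff_shellCutoff k)
    exact (h1.comp (contDiff_affineSq 1 0)).smul (contDiff_const (c := (1 : Cl n)))
  have hsupp : Function.support (shellTest (n := n) k) ⊆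
      {x | 1 ≤ (k + 2) * affineSq 1 0 x} ∩ {x | affineSq 1 0 x ≤ k + 3} := by
    intro x hx
    by_contra h
    apply hx
    rw [Set.mem_inter_iff, Set.mem_ofPred_eq, Set.mem_ofPred_eq, not_and_or, not_le, not_le] at h
    rcases h with h | h
    · rw [shellTest, shellGaussian, shellCutoff_of_le h.le, mul_zero, zero_smul]
    · rw [shellTest, shellGaussian, shellCutoff_of_ge h.le, mul_zero, zero_smul]
  have hclosed : IsClosed ({x : Eucl n | 1 ≤ (k + 2) * affineSq 1 0 x} ∩
      {x | affineSq 1 0 x ≤ k + 3}) :=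
    (isClosed_le continuous_const (continuous_const.mul hcont)).inter
      (isClosed_le hcont continuous_const)
  have htsupp := closure_minimal hsupp hclosed
  refine ⟨hsmooth, ?_, fun x hx => ?_⟩
  · refine HasCompactSupport.of_support_subset_isCompact
      (isCompact_closedBall (0 : Eucl n) (k + 3)) fun x hx => ?_
    have h1 := (hsupp hx).2
    rw [Set.mem_ofPred_eq, affineSq_one_zero] at h1
    rw [mem_closedBall_zero_iff]
    nlinarith [norm_nonneg x]
  · have h1 := (htsupp hx).1
    rw [Set.mem_ofPred_eq, affineSq_one_zero] at h1
    rintro rfl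
    norm_num at h1

theorem norm_one_cl : ‖(1 : Cl n)‖ = 1 := by
  have h : ‖(1 : Cl n)‖ ^ 2 = 1 := by
    rw [← real_inner_self_eq_norm_sq, Cl.inner_eq_sum_coeffs, Cl.coeffs_one]
    simp [Pi.single_apply]
  exact (pow_eq_one_iff_of_nonneg (norm_nonneg _) two_ne_zero).1 h

theorem norm_twist_shellTest_sq (k : ℕ) (x : Eucl n) :
    ‖twist 1 0 (shellTest k) x‖ ^ 2 = ‖x‖ ^ 2 * shellGaussian k (‖x‖ ^ 2) ^ 2 := by
  rw [norm_twist_sq, affineSq_one_zero, shellTest, norm_smul, norm_one_cl, mul_one,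
    Real.norm_eq_abs, sq_abs, affineSq_one_zero]

/-- The uncut Gaussian solves `Dg = -x g` exactly, so only the derivative of the cutoff survives. -/
theorem norm_diracOp_shellTest_sub (k : ℕ) (x : Eucl n) :
    affineSq 1 0 x * ‖diracOp (shellTest k) x - ((2 : ℝ) / 2) • twist 1 0 (shellTest k) x‖ ^ 2 =
      4 * Real.exp (-‖x‖ ^ 2) * (‖x‖ ^ 2 * deriv (shellCutoff k) (‖x‖ ^ 2)) ^ 2 := by
  have hD : diracOp (shellTest k) x =
      Cl.vec (gradVec (fun y => shellGaussian k (affineSq 1 0 y)) x) * 1 := by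
    have h1 : DifferentiableAt ℝ (fun y : Eucl n => shellGaussian k (affineSq 1 0 y)) x :=
      (hasDerivAt_shellGaussian k _).differentiableAt.comp x (differentiable_affineSq x)
    have := diracOp_smul h1 (differentiableAt_const (1 : Cl n))
    change diracOp (fun y => shellGaussian k (affineSq 1 0 y) • (1 : Cl n)) x = _
    rw [this]
    have h2 : diracOp (fun _ : Eucl n => (1 : Cl n)) x = 0 := by simp [diracOp]
    rw [h2, smul_zero, zero_add]
  have hg : gradVec (fun y : Eucl n => shellGaussian k (affineSq 1 0 y)) x =
      (2 * (Real.exp (-‖x‖ ^ 2 / 2) * deriv (shellCutoff k) (‖x‖ ^ 2)) -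
        shellGaussian k (‖x‖ ^ 2)) • affineField 1 0 x := by
    rw [gradVec_comp (differentiable_affineSq x) (hasDerivAt_shellGaussian k _), gradVec_affineSq,
      affineSq_one_zero]
    ext j
    simp only [Pi.smul_apply, Pi.one_apply, smul_eq_mul]; ring
  have hsub : diracOp (shellTest k) x - ((2 : ℝ) / 2) • twist 1 0 (shellTest k) x =
      (2 * (Real.exp (-‖x‖ ^ 2 / 2) * deriv (shellCutoff k) (‖x‖ ^ 2))) •
        (Cl.vec (affineField 1 0 x) * 1) := by
    rw [hD, hg, twist, shellTest, Cl.vec_smul, smul_mul_assoc, mul_smul_comm, affineSq_one_zero]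
    module
  rw [hsub, norm_smul, mul_pow, Cl.norm_vec_mul_sq, norm_one_cl, Real.norm_eq_abs, sq_abs]
  change _ * (_ * (affineSq 1 0 x * _)) = _
  have hexp : Real.exp (-‖x‖ ^ 2) = Real.exp (-‖x‖ ^ 2 / 2) ^ 2 := by
    rw [← Real.exp_nat_mul]; congr 1; push_cast; ring
  rw [affineSq_one_zero, hexp]; ring

/-- Dominated convergence: at each point the cutoff derivative is eventually zero, or the factor
`|x|²` vanishes, and the uniform bound on `t χ'(t)` grows only linearly against the Gaussian. -/
theorem tendsto_shell_remainder : Filter.Tendsto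
    (fun k : ℕ => ∫ x : Eucl n, 4 * Real.exp (-‖x‖ ^ 2) *
      (‖x‖ ^ 2 * deriv (shellCutoff k) (‖x‖ ^ 2)) ^ 2) Filter.atTop (nhds 0) := by
  obtain ⟨M, hM0, hM⟩ := exists_abs_deriv_smoothTransition_le
  have hlim := tendsto_integral_of_dominated_convergence (μ := (volume : Measure (Eucl n)))
    (F := fun (k : ℕ) (x : Eucl n) => 4 * Real.exp (-‖x‖ ^ 2) *
      (‖x‖ ^ 2 * deriv (shellCutoff k) (‖x‖ ^ 2)) ^ 2) (f := fun _ => (0 : ℝ))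
    (fun x => 64 * M ^ 2 * Real.exp (-(1 / 2) * ‖x‖ ^ 2)) (fun k => ?_)
    ((integrable_exp_neg_mul_norm_sq (by norm_num)).const_mul _) (fun k => ?_) ?_
  · simpa using hlim
  · have h1 : Continuous (deriv (shellCutoff k)) :=
      (contDiff_shellCutoff k).continuous_deriv (by simp)
    have h2 : Continuous fun x : Eucl n => deriv (shellCutoff k) (‖x‖ ^ 2) :=
      h1.comp (by fun_prop)
    exact Continuous.aestronglyMeasurable (by fun_prop)
  · refine Filter.Eventually.of_forall fun x => ?_
    set t := ‖x‖ ^ 2 with ht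
    have ht0 : 0 ≤ t := sq_nonneg _
    have h1 := abs_mul_deriv_shellCutoff_le hM0 hM k ht0
    -- The exponent `t/4`, doubled by squaring, uses up half of `e^{-t}` and leaves an integrable
    -- Gaussian.
    have h2 : 2 + t ≤ 4 * Real.exp (t / 4) := by
      have := Real.add_one_le_exp (t / 4)
      linarith
    have h3 : (t * deriv (shellCutoff k) t) ^ 2 ≤ (M * (4 * Real.exp (t / 4))) ^ 2 := by
      rw [← sq_abs]
      exact pow_le_pow_left₀ (abs_nonneg _) (h1.trans (by gcongr)) 2
    rw [Real.norm_of_nonneg (by positivity)]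
    calc 4 * Real.exp (-t) * (t * deriv (shellCutoff k) t) ^ 2 ≤
        4 * Real.exp (-t) * (M * (4 * Real.exp (t / 4))) ^ 2 := by gcongr
      _ = 64 * M ^ 2 * (Real.exp (-t) * Real.exp (t / 4) ^ 2) := by ring
      _ = 64 * M ^ 2 * Real.exp (-(1 / 2) * t) := by
          rw [← Real.exp_nat_mul, ← Real.exp_add]
          congr 2
          push_cast; ring
  · refine Filter.Eventually.of_forall fun x => ?_
    refine tendsto_const_nhds.congr' ?_
    by_cases hx : x = 0
    · exact Filter.Eventually.of_forall fun k => by simp [hx]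
    · filter_upwards [eventually_deriv_shellCutoff_eq_zero
        (by positivity : 0 < ‖x‖ ^ 2)] with k hk
      rw [hk]; ring

/-- On the shell `1 < |x|² < 2` every cutoff equals `1`, so the mass there is independent of `k` and
the normalized remainder also tends to zero. -/
theorem exists_pos_le_integral_shell (hn : 0 < n) :
    ∃ c : ℝ, 0 < c ∧ ∀ k, c ≤ ∫ x : Eucl n, ‖twist 1 0 (shellTest k) x‖ ^ 2 := by
  set U : Set (Eucl n) := {x | 1 < ‖x‖ ^ 2} ∩ {x | ‖x‖ ^ 2 < 2} with hU
  have hUo : IsOpen U := (isOpen_lt continuous_const (by fun_prop)).inter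
    (isOpen_lt (by fun_prop) continuous_const)
  have hUne : U.Nonempty := by
    refine ⟨EuclideanSpace.single ⟨0, hn⟩ (5 / 4 : ℝ), ?_, ?_⟩ <;>
    · rw [Set.mem_ofPred_eq, PiLp.norm_single]
      norm_num
  have hUb : volume U < ⊤ := by
    refine (measure_mono fun x hx => ?_).trans_lt
      (measure_closedBall_lt_top (x := (0 : Eucl n)) (r := 2))
    have h1 : ‖x‖ ^ 2 < 2 := hx.2
    rw [mem_closedBall_zero_iff]
    nlinarith [norm_nonneg x]
  have hpos : 0 < volume.real U :=
    ENNReal.toReal_pos (hUo.measure_pos volume hUne).ne' hUb.ne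
  refine ⟨volume.real U * Real.exp (-2), by positivity, fun k => ?_⟩
  have hw : IsTest {0}ᶜ (twist 1 0 (shellTest (n := n) k)) :=
    (isTest_shellTest k).twist 1 0 isOpen_compl_singleton
  rw [← smul_eq_mul, ← integral_indicator_const _ hUo.measurableSet]
  refine integral_mono ((integrable_indicator_iff hUo.measurableSet).2
    (integrableOn_const hUb.ne)) hw.integrable_sq fun x => ?_
  by_cases hx : x ∈ U
  · have h1 : 1 < ‖x‖ ^ 2 := hx.1
    have h2 : ‖x‖ ^ 2 < 2 := hx.2
    simp only [Set.indicator_of_mem hx]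
    rw [norm_twist_shellTest_sq, shellGaussian, shellCutoff_eq_one h1.le h2.le, mul_one,
      ← Real.exp_nat_mul]
    have h3 : Real.exp (-2) ≤ Real.exp ((2 : ℕ) * (-‖x‖ ^ 2 / 2)) := by
      apply Real.exp_le_exp.2
      push_cast; linarith
    nlinarith [Real.exp_pos ((2 : ℕ) * (-‖x‖ ^ 2 / 2))]
  · simp only [Set.indicator_of_notMem hx]
    positivity

/-- The constant `1/4` in the dual Gaussian estimate on `ℝⁿ \ {0}` is optimal. -/
theorem one_fourth_le_of_estimate (hn : 0 < n) {C : ℝ}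
    (H : ∀ v : Eucl n → Cl n, IsTest {0}ᶜ v →
      ∫ x, Real.exp (‖x‖ ^ 2) * ‖v x‖ ^ 2 ≤ C * ∫ x, Real.exp (‖x‖ ^ 2) * ‖diracOp v x‖ ^ 2) :
    1 / 4 ≤ C := by
  have hΩ : IsOpen ({0}ᶜ : Set (Eucl n)) := isOpen_compl_singleton
  obtain ⟨c, hc0, hc⟩ := exists_pos_le_integral_shell hn
  have key : ∀ k, (1 - 4 * C) * (∫ x : Eucl n, ‖twist 1 0 (shellTest k) x‖ ^ 2) ≤
      C * ∫ x : Eucl n, 4 * Real.exp (-‖x‖ ^ 2) *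
        (‖x‖ ^ 2 * deriv (shellCutoff k) (‖x‖ ^ 2)) ^ 2 := by
    intro k
    have hg := isTest_shellTest (n := n) k
    have hw := hg.twist 1 0 hΩ
    have hφc : ContDiff ℝ ∞ (affineSq (n := n) 1 0) := contDiff_affineSq 1 0
    have hv : IsTest {0}ᶜ (fun x : Eucl n =>
        Real.exp (-(affineSq 1 0 x / 2)) • twist 1 0 (shellTest k) x) :=
      hw.smul hΩ (hφc.div_const 2).neg.exp.contDiffOn
    obtain ⟨g, -, hgw, hgD⟩ := exists_twist_eq (α := 1) (β := 0) (k := fun _ => 2) hΩ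
      hφc.contDiffOn (fun x hx => by
        rw [affineSq_one_zero]
        have : x ≠ 0 := hx
        positivity)
      (fun x _ => by rw [gradVec_affineSq]; simp) hv
    have hgw' : twist 1 0 g = twist 1 0 (shellTest k) := by
      ext1 x
      rw [hgw, smul_smul, ← Real.exp_add, add_neg_cancel, Real.exp_zero, one_smul]
    have hmain := integral_norm_sq_weighted (α := 1) (β := 0) hg hΩ (k := fun _ => 2)
      contDiffOn_const
    rw [hgw'] at hgD
    simp only [← hgD, twistDefect_one, integral_zero, add_zero,
      norm_diracOp_shellTest_sub] at hmain
    have hZ : ∀ x : Eucl n, (∑ j, affineField 1 0 x j *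
        gradVec (fun y => affineSq 1 0 y * 2) x j) * ‖shellTest k x‖ ^ 2 =
        4 * ‖twist 1 0 (shellTest k) x‖ ^ 2 := by
      intro x
      have h1 : gradVec (fun y : Eucl n => affineSq 1 0 y * 2) x =
          (2 : ℝ) • gradVec (affineSq 1 0) x :=
        gradVec_comp (F := fun t => t * 2) (differentiable_affineSq x)
          (by simpa using (hasDerivAt_id (affineSq 1 0 x)).mul_const 2)
      rw [h1, gradVec_affineSq, norm_twist_sq, ← mul_assoc, affineSq, Finset.mul_sum]
      congr 1
      refine Finset.sum_congr rfl fun j _ => ?_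
      simp only [Pi.smul_apply, Pi.one_apply, smul_eq_mul]; ring
    simp only [hZ] at hmain
    rw [integral_const_mul] at hmain
    have h2 := H _ hv
    have h3 : ∀ x : Eucl n, Real.exp (‖x‖ ^ 2) *
        ‖Real.exp (-(affineSq 1 0 x / 2)) • twist 1 0 (shellTest k) x‖ ^ 2 =
        ‖twist 1 0 (shellTest k) x‖ ^ 2 := by
      intro x
      rw [norm_smul, mul_pow, Real.norm_eq_abs, sq_abs, ← Real.exp_nat_mul, ← mul_assoc,
        ← Real.exp_add, affineSq_one_zero]
      have : ‖x‖ ^ 2 + (2 : ℕ) * -(‖x‖ ^ 2 / 2) = 0 := by push_cast; ring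
      rw [this, Real.exp_zero, one_mul]
    simp only [h3] at h2
    simp only [← affineSq_one_zero] at h2 hmain ⊢
    rw [hmain] at h2
    linarith
  by_contra hlt
  have h1 : 0 < (1 - 4 * C) * c := mul_pos (by linarith) hc0
  have h2 := (tendsto_shell_remainder (n := n)).const_mul C
  rw [mul_zero] at h2
  obtain ⟨k, hk⟩ := (h2.eventually_lt_const h1).exists
  have h3 := key k
  have h4 : (1 - 4 * C) * c ≤ (1 - 4 * C) *
      (∫ x : Eucl n, ‖twist 1 0 (shellTest k) x‖ ^ 2) :=
    mul_le_mul_of_nonneg_left (hc k) (by linarith)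
  linarith

end

theorem exists_diracEq_of_const_estimate {n : ℕ} {Ω : Set (Eucl n)} (hΩ : IsOpen Ω)
    {φ : Eucl n → ℝ} (hφ : ContinuousOn φ Ω) {c : ℝ} (hc : 0 < c)
    (hest : ∀ v : Eucl n → Cl n, IsTest Ω v →
      ∫ x, c * Real.exp (φ x) * ‖v x‖ ^ 2 ≤ ∫ x, Real.exp (φ x) * ‖diracOp v x‖ ^ 2)
    {f : Eucl n → Cl n} (hf : MemL2 Ω φ f) :
    ∃ u : Eucl n → Cl n, MemL2 Ω φ u ∧ DiracEq Ω u f ∧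
      wNormSq Ω φ u ≤ ENNReal.ofReal (1 / c) * wNormSq Ω φ f := by
  have h : wInt Ω φ (fun x => ‖f x‖ ^ 2 / c) = ENNReal.ofReal (1 / c) * wNormSq Ω φ f := by
    rw [wNormSq, wInt, wInt, ← MeasureTheory.lintegral_const_mul' _ _ ENNReal.ofReal_ne_top]
    refine MeasureTheory.lintegral_congr fun x => ?_
    rw [← ENNReal.ofReal_mul (by positivity)]
    congr 1
    ring
  have hlt : wInt Ω φ (fun x => ‖f x‖ ^ 2 / c) < ⊤ := by
    rw [h]
    exact ENNReal.mul_lt_top ENNReal.ofReal_lt_top hf.2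
  rw [← h]
  exact exists_diracEq_of_estimate hΩ hφ continuousOn_const (fun _ _ => hc) hest hf.1 hlt

theorem theorem1p3 (n : ℕ) (hn : 2 ≤ n) :
    -- (1) radial weights `φ = |x|^m`
    (∀ m : ℝ, m ≠ 0 → ∀ Ω : Set (Eucl n), IsOpen Ω → IsConnected Ω → Ω ⊆ {0}ᶜ →
      ∀ f : Eucl n → Cl n, MemL2 Ω (fun x => ‖x‖ ^ m) f →
        wInt Ω (fun x => ‖x‖ ^ m) (fun x => ‖f x‖ ^ 2 / ‖x‖ ^ (m - 2)) < ⊤ →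
        ∃ u : Eucl n → Cl n, MemL2 Ω (fun x => ‖x‖ ^ m) u ∧ DiracEq Ω u f ∧
          wNormSq Ω (fun x => ‖x‖ ^ m) u ≤
            wInt Ω (fun x => ‖x‖ ^ m) (fun x => ‖f x‖ ^ 2 / (m ^ 2 * ‖x‖ ^ (m - 2)))) ∧
    -- the Gaussian weight `φ = |x|²`
    (∀ Ω : Set (Eucl n), IsOpen Ω → IsConnected Ω → Ω ⊆ {0}ᶜ →
      ∀ f : Eucl n → Cl n, MemL2 Ω (fun x => ‖x‖ ^ 2) f →
        ∃ u : Eucl n → Cl n, MemL2 Ω (fun x => ‖x‖ ^ 2) u ∧ DiracEq Ω u f ∧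
          wNormSq Ω (fun x => ‖x‖ ^ 2) u ≤
            ENNReal.ofReal (1 / 4) * wNormSq Ω (fun x => ‖x‖ ^ 2) f) ∧
    -- sharpness of `1/4` on `ℝⁿ \ {0}`
    (∀ C : ℝ,
      (∀ f : Eucl n → Cl n, MemL2 {0}ᶜ (fun x => ‖x‖ ^ 2) f →
        ∃ u : Eucl n → Cl n, MemL2 {0}ᶜ (fun x => ‖x‖ ^ 2) u ∧ DiracEq {0}ᶜ u f ∧
          wNormSq {0}ᶜ (fun x => ‖x‖ ^ 2) u ≤
            ENNReal.ofReal C * wNormSq {0}ᶜ (fun x => ‖x‖ ^ 2) f) →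
      1 / 4 ≤ C) ∧
    -- (2) the weight `φ = x₁²`
    (∀ Ω : Set (Eucl n), IsOpen Ω → IsConnected Ω →
      ∀ f : Eucl n → Cl n, MemL2 Ω (fun x => x ⟨0, by omega⟩ ^ 2) f →
        ∃ u : Eucl n → Cl n, MemL2 Ω (fun x => x ⟨0, by omega⟩ ^ 2) u ∧ DiracEq Ω u f ∧
          wNormSq Ω (fun x => x ⟨0, by omega⟩ ^ 2) u ≤
            ENNReal.ofReal (1 / 2) * wNormSq Ω (fun x => x ⟨0, by omega⟩ ^ 2) f) ∧
    -- (3) perturbed Gaussian weights `φ = ∑ aᵢ xᵢ²`; `ε` depends only on `n`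
    (∃ ε : ℝ, 0 < ε ∧ ∀ a : Fin n → ℝ, (∀ i, |a i - 1| < ε) →
      ∀ Ω : Set (Eucl n), IsOpen Ω → IsConnected Ω → Ω ⊆ (Metric.closedBall 0 1)ᶜ →
      ∀ f : Eucl n → Cl n, MemL2 Ω (fun x => ∑ i, a i * x i ^ 2) f →
        ∃ u : Eucl n → Cl n, MemL2 Ω (fun x => ∑ i, a i * x i ^ 2) u ∧ DiracEq Ω u f ∧
          wNormSq Ω (fun x => ∑ i, a i * x i ^ 2) u ≤
            ENNReal.ofReal (1 / 3) * wNormSq Ω (fun x => ∑ i, a i * x i ^ 2) f) := by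
  have hrpow : ∀ x : Eucl n, ‖x‖ ^ (2 : ℝ) = ‖x‖ ^ 2 := fun x => by
    rw [← Real.rpow_natCast]; norm_num
  refine ⟨?_, ?_, ?_, ?_, ?_⟩
  · intro m hm Ω hΩ _ h0 f hf hfi
    have hne : ∀ x ∈ Ω, ‖x‖ ≠ 0 := fun x hx => norm_ne_zero_iff.2 (h0 hx)
    have hpow : ∀ p : ℝ, ContinuousOn (fun x : Eucl n => ‖x‖ ^ p) Ω := fun p =>
      continuous_norm.continuousOn.rpow_const fun x hx => Or.inl (hne x hx)
    refine exists_diracEq_of_estimate (ψ := fun x => m ^ 2 * ‖x‖ ^ (m - 2)) hΩ (hpow m) (continuousOn_const.mul (hpow (m - 2)))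
      (fun x hx => ?_) (fun v hv => radial_estimate m hΩ h0 hv) hf.1 ?_
    · have := (norm_nonneg x).lt_of_ne' (hne x hx)
      positivity
    · have : wInt Ω (fun x => ‖x‖ ^ m) (fun x => ‖f x‖ ^ 2 / (m ^ 2 * ‖x‖ ^ (m - 2))) =
          ENNReal.ofReal (1 / m ^ 2) *
            wInt Ω (fun x => ‖x‖ ^ m) (fun x => ‖f x‖ ^ 2 / ‖x‖ ^ (m - 2)) := by
        rw [wInt, wInt, ← MeasureTheory.lintegral_const_mul' _ _ ENNReal.ofReal_ne_top]
        refine MeasureTheory.lintegral_congr fun x => ?_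
        rw [← ENNReal.ofReal_mul (by positivity), ← mul_assoc, one_div_mul_eq_div, div_div,
          mul_comm (‖x‖ ^ (m - 2))]
      rw [this]
      exact ENNReal.mul_lt_top ENNReal.ofReal_lt_top hfi
  · intro Ω hΩ _ h0 f hf
    refine exists_diracEq_of_const_estimate hΩ (by fun_prop) (by norm_num) (fun v hv => ?_) hf
    have h := radial_estimate 2 hΩ h0 hv
    simp only [hrpow, sub_self, Real.rpow_zero, mul_one] at h
    norm_num at h
    exact h
  · intro C hC
    have h : 1 / 4 ≤ max C 0 := by
      refine one_fourth_le_of_estimate (n := n) (by omega) fun v hv => ?_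
      refine integral_le_of_solvable isOpen_compl_singleton (φ := fun x => ‖x‖ ^ 2)
        (by fun_prop) (le_max_right _ _) (fun f hf => ?_) hv
      obtain ⟨u, hu1, hu2, hu3⟩ := hC f hf
      exact ⟨u, hu1, hu2, hu3.trans (by gcongr; exact le_max_left _ _)⟩
    rcases le_max_iff.1 h with h | h
    · exact h
    · norm_num at h
  · intro Ω hΩ _ f hf
    exact exists_diracEq_of_const_estimate hΩ (by fun_prop) (by norm_num)
      (fun v hv => coordinate_estimate _ hΩ hv) hf
  · refine ⟨1 / (n + 9), by positivity, fun a ha Ω hΩ _ h0 f hf => ?_⟩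
    exact exists_diracEq_of_const_estimate hΩ (by fun_prop) (by norm_num)
      (fun v hv => perturbed_estimate (fun i => (ha i).le) hΩ h0 hv) hf
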